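/- **Theorem 4.2.** Work in $\mathbb{C}^2$ with coordinates $(z,w)$ and the standard symplectic form. For $r,s>0$ let $L(r,s)=\{(z,w) : \pi|z|^2=r,\ \pi|w|^2=s\}$ be the product Lagrangian torus, and for $a,b>0$ let $$Q(a,b)=\{(z,w)\in\mathbb{C}^2 : (\pi|z|^2,\pi|w|^2)\in q(a,b)\},\qquad q(a,b)=\Big\{(x,y)\in\mathbb{R}^2 : 0\le x\le 2a-\frac{ay}{a+b},\ 0\le y\le a+b\Big\}.$$ Let $0<a<b$ and $\epsilon>0$. Then there is a Hamiltonian isotopy of Lagrangian tori $\{L_t\}_{t\in[0,1]}$ with $L_0=L(a,b)$ (that is, $L_t=\phi_t(L(a,b))$, where $\phi_t$ is the flow, starting at the identity, of a smooth time-dependent Hamiltonian on $\mathbb{C}^2$ that vanishes outside a compact set) such that 1. $L_t\subset Q(a+\epsilon,b+\epsilon)$ for every $t\in[0,1]$; 2. $L_1\subset Q(a+\epsilon,a+\epsilon)$. -/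

import Mathlib

open Set
open scoped ContDiff

/-- The standard symplectic form `dx₁ ∧ dy₁ + dx₂ ∧ dy₂` on `ℂ² = ℂ × ℂ`, with coordinates
`(z, w) = (x₁ + i y₁, x₂ + i y₂)`; note that `dx ∧ dy (u, v) = Im (conj u * v)` on `ℂ`. -/
def omegaStd (u v : ℂ × ℂ) : ℝ :=
  (u.1.re * v.1.im - u.1.im * v.1.re) + (u.2.re * v.2.im - u.2.im * v.2.re)

/-- `X` is the value at `p` of the Hamiltonian vector field of `h`, for the sign convention
`ι_X ω = -dh`. As the form is nondegenerate, there is exactly one such `X`. -/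
def IsHamiltonianVectorAt (h : ℂ × ℂ → ℝ) (p X : ℂ × ℂ) : Prop :=
  ∀ v : ℂ × ℂ, omegaStd X v = -(fderiv ℝ h p v)

/-- `φ_t`, `t ∈ [0,1]`, is a (compactly supported) Hamiltonian isotopy of `ℂ²`: the flow, starting
at the identity, of a smooth time-dependent Hamiltonian `H : [0,1] × ℂ² → ℝ` which vanishes outside
a compact subset of `ℂ²`. By the theory of ordinary differential equations `φ` is determined by `H`,
and every `φ_t` is automatically a diffeomorphism preserving the symplectic form.
Only the times `t ∈ [0,1]` matter. -/
def IsHamiltonianFlow (φ : ℝ → ℂ × ℂ → ℂ × ℂ) : Prop :=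
  ∃ H : ℝ → ℂ × ℂ → ℝ,
    ContDiffOn ℝ ∞ (fun x : ℝ × (ℂ × ℂ) => H x.1 x.2) (Icc (0 : ℝ) 1 ×ˢ univ) ∧
    (∃ K : Set (ℂ × ℂ), IsCompact K ∧ ∀ t ∈ Icc (0 : ℝ) 1, ∀ p ∉ K, H t p = 0) ∧
    (∀ p, φ 0 p = p) ∧
    ∀ p, ∀ t ∈ Icc (0 : ℝ) 1, ∃ X : ℂ × ℂ,
      IsHamiltonianVectorAt (H t) (φ t p) X ∧
      HasDerivWithinAt (fun s => φ s p) X (Icc (0 : ℝ) 1) t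

/-- The family of subsets `L_t ⊆ ℂ²`, `t ∈ [0,1]`, is a Hamiltonian isotopy of subsets:
`L_t = φ_t(L_0)` for a Hamiltonian isotopy `φ` of `ℂ²`. When `L_0` is an embedded Lagrangian torus,
so is every `L_t`. -/
def IsHamiltonianIsotopy (L : ℝ → Set (ℂ × ℂ)) : Prop :=
  ∃ φ : ℝ → ℂ × ℂ → ℂ × ℂ, IsHamiltonianFlow φ ∧ ∀ t ∈ Icc (0 : ℝ) 1, L t = φ t '' L 0

/-- The product Lagrangian torus `L(r, s) = {π|z|² = r, π|w|² = s}`. -/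
def productTorus (r s : ℝ) : Set (ℂ × ℂ) :=
  {p | Real.pi * ‖p.1‖ ^ 2 = r ∧ Real.pi * ‖p.2‖ ^ 2 = s}

/-- The quadrilateral `q(a, b)` with vertices `(0, 0)`, `(2a, 0)`, `(a, a + b)`, `(0, a + b)`. -/
def quadRegion (a b : ℝ) : Set (ℝ × ℝ) :=
  {v | 0 ≤ v.1 ∧ v.1 ≤ 2 * a - a * v.2 / (a + b) ∧ 0 ≤ v.2 ∧ v.2 ≤ a + b}

/-- The toric domain in `ℂ²` with moment image `Ω`. -/
def toricDomain (Ω : Set (ℝ × ℝ)) : Set (ℂ × ℂ) :=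
  {p | (Real.pi * ‖p.1‖ ^ 2, Real.pi * ‖p.2‖ ^ 2) ∈ Ω}

/-- The toric domain `Q(a, b)` over the quadrilateral `q(a, b)`. -/
def quadDomain (a b : ℝ) : Set (ℂ × ℂ) := toricDomain (quadRegion a b)

/-!
All Hamiltonians below are products `f(z) g(w)`. Such a Hamiltonian has an explicit flow in terms
of the flows of `f` and `g` on the plane (`productFlow`), because both are conserved. On the plane,
area-angle coordinates `(u, v)` (`area`, `turn`, `pol`) linearize everything: a function of the
angle moves points along rays, a function of the area rotates them, and in general `u' = -∂ᵥF`,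
`v' = ∂ᵤF` (`planeHamVec_polar`). Hamiltonian isotopies are concatenated in
`IsHamiltonianFlow.concat`, so it suffices to exhibit the isotopy as a sequence of such moves. Each
of them is an inclusion statement: `Movable V L L'` says that `L` can be moved inside `V` into `L'`.

If `b ≤ 2a + 2ε`, the torus lies in both domains from the start. Otherwise the two factors of the
torus are deformed in four moves, where `0 < η ≤ ε / 20`, the coordinates of `z` are
`(x, y)`, and those of `w` are `(u, v)`.

* Both circles are opened to curves in the slit plane (`exists_keyhole`, `movable_to_sectors`), so
  that the angle becomes a smooth function on them. The first curve stays in `x ≤ a + η`. The second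
  one encircles its area `b` with radial profile about `b + a` on the half turn `v < 1/2` and
  `b - a` on the half turn `v > 1/2`.
* The half turn `v > 1/2` of the second curve is moved outwards by an area `2a + 10η`
  (`movable_lift`). Now the curve starts from an arc near the center with `v ≤ 1/2`; one end of it
  runs along a ray near `v = 0` to an outer arc at area at least `b`, the other end climbs near
  `v = 1/2` to area `2a + 10η` and joins the outer arc along the slit, near `v = 1`. The area stays
  below `(b - a) + (2a + 10η) = a + b + 10η`, which fits in the larger quadrilateral.
* The fold `-y σ(u)` (`movable_fold`) trades area of `w` for area of `z`: with
  `σ(u) ≈ (2a + 8η - u) / 2`, a point at small `u` ends at `x + u/2 ≤ 2a + 20η`, below the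
  slanted edges of both quadrilaterals; the edge of the smaller one has this slope. The center
  ends at `x ≥ a + 2η`, while the outer arc does not move.
* The Hamiltonian `χ(x) G(w)` of `movable_shrink` pulls the outer arc in to area at most `2a + 20η`.
  On the outer arc `G` is a function of the angle. Its values at the two ends differ by the
  area to be removed, so `G` cannot be constant along the inner part of the curve, which connects
  them. The cutoff `χ`, which vanishes for `x ≥ a + 2η`, switches `G` off near the center; this is
  what the fold is for.
-/

/-! ### Autonomous Hamiltonian flows in the plane -/

/-- A bounded Lipschitz vector field has a global flow. -/
theorem exists_globalFlow {E : Type*} [NormedAddCommGroup E] [NormedSpace ℝ E] [CompleteSpace E]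
    {f : E → E} {K M : NNReal} (hl : LipschitzWith K f) (hb : ∀ x, ‖f x‖ ≤ M) :
    ∃ Φ : ℝ → E → E, (∀ x, Φ 0 x = x) ∧ ∀ x t, HasDerivAt (fun s => Φ s x) (f (Φ t x)) t := by
  have key : ∀ (x : E) (n : ℕ), ∃ α : ℝ → E, α 0 = x ∧
      ∀ t ∈ Ioo (-(n + 1 : ℝ)) (n + 1), HasDerivAt α (f (α t)) t := by
    intro x n
    have h0 : (0 : ℝ) ∈ Icc (-(n + 1 : ℝ)) (n + 1) := ⟨by linarith [n.cast_nonneg (α := ℝ)],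
      by linarith [n.cast_nonneg (α := ℝ)]⟩
    have hP : IsPicardLindelof (fun _ => f) (⟨0, h0⟩ : Icc (-(n + 1 : ℝ)) (n + 1)) x
        (M * (n + 1)) 0 M K :=
      IsPicardLindelof.of_time_independent (fun y _ => hb y) hl.lipschitzOnWith (by simp)
    obtain ⟨α, h1, h2⟩ := hP.exists_eq_forall_mem_Icc_hasDerivWithinAt₀
    exact ⟨α, h1, fun t ht => (h2 t (Ioo_subset_Icc_self ht)).hasDerivAt (Icc_mem_nhds ht.1 ht.2)⟩
  choose α hα0 hα using key
  have agree : ∀ x (m n : ℕ), m ≤ n → EqOn (α x m) (α x n) (Ioo (-(m + 1 : ℝ)) (m + 1)) := by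
    intro x m n hmn
    have hmn' : (m : ℝ) ≤ n := by exact_mod_cast hmn
    refine ODE_solution_unique_of_mem_Ioo (v := fun _ => f) (s := fun _ => univ) (K := K)
      (t₀ := 0) (fun _ _ => hl.lipschitzOnWith) ?_ ?_ ?_ ?_
    · constructor <;> linarith [m.cast_nonneg (α := ℝ)]
    · exact fun t ht => ⟨hα x m t ht, trivial⟩
    · exact fun t ht => ⟨hα x n t ⟨by linarith [ht.1], by linarith [ht.2]⟩, trivial⟩
    · rw [hα0, hα0]
  have agree' : ∀ x (m n : ℕ) (t : ℝ), |t| < m + 1 → |t| < n + 1 → α x m t = α x n t := by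
    intro x m n t hm hn
    rcases le_total m n with h | h
    · exact agree x m n h (abs_lt.1 hm)
    · exact (agree x n m h (abs_lt.1 hn)).symm
  have hlt : ∀ t : ℝ, |t| < (⌈|t|⌉₊ : ℝ) + 1 := fun t => by linarith [Nat.le_ceil |t|]
  refine ⟨fun t x => α x ⌈|t|⌉₊ t, fun x => hα0 x _, fun x t => ?_⟩
  refine (hα x ⌈|t|⌉₊ t (abs_lt.1 (hlt t))).congr_of_eventuallyEq ?_
  have : ∀ᶠ s in nhds t, |s| < (⌈|t|⌉₊ : ℝ) + 1 :=
    (continuous_abs.tendsto t).eventually_lt_const (hlt t)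
  filter_upwards [this] with s hs
  exact agree' x _ _ s (hlt s) hs

/-- The Hamiltonian vector field `-∂h/∂y + i ∂h/∂x` of a function on the plane `ℂ`, for the sign
convention `ι_X ω = -dh`. -/
noncomputable def planeHamVec (h : ℂ → ℝ) (z : ℂ) : ℂ :=
  ⟨-fderiv ℝ h z Complex.I, fderiv ℝ h z 1⟩

/-- Smooth real functions of compact support on the plane. -/
structure IsTestFun (h : ℂ → ℝ) : Prop where
  smooth : ContDiff ℝ ∞ h
  compact : HasCompactSupport h

open Classical in
/-- The Hamiltonian flow of a smooth function of compact support on the plane (and the constant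
flow if there is no global flow). -/
noncomputable def planeFlow (h : ℂ → ℝ) : ℝ → ℂ → ℂ :=
  if H : ∃ Φ : ℝ → ℂ → ℂ, (∀ z, Φ 0 z = z) ∧
    ∀ z t, HasDerivAt (fun s => Φ s z) (planeHamVec h (Φ t z)) t then H.choose else fun _ z => z

theorem planeHamVec_eq (h : ℂ → ℝ) : planeHamVec h = fun z =>
    (-fderiv ℝ h z Complex.I) • (1 : ℂ) + (fderiv ℝ h z 1) • Complex.I := by
  ext z; apply Complex.ext <;> simp [planeHamVec]

theorem fderiv_apply_eq (h : ℂ → ℝ) (z v : ℂ) :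
    fderiv ℝ h z v = v.re * fderiv ℝ h z 1 + v.im * fderiv ℝ h z Complex.I := by
  have : v = v.re • (1 : ℂ) + v.im • Complex.I := by apply Complex.ext <;> simp
  conv_lhs => rw [this]
  simp only [map_add, map_smul, smul_eq_mul]

theorem planeHamVec_congr {h k : ℂ → ℝ} {z : ℂ} (H : h =ᶠ[nhds z] k) :
    planeHamVec h z = planeHamVec k z := by
  simp only [planeHamVec, H.fderiv_eq]

theorem planeHamVec_const (c : ℝ) (z : ℂ) : planeHamVec (fun _ => c) z = 0 := by
  apply Complex.ext <;> simp [planeHamVec]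

theorem planeHamVec_eq_zero_of_notMem_tsupport {h : ℂ → ℝ} {z : ℂ} (hz : z ∉ tsupport h) :
    planeHamVec h z = 0 := by
  rw [planeHamVec_congr (notMem_tsupport_iff_eventuallyEq.1 hz)]
  exact planeHamVec_const 0 z

namespace IsTestFun

variable {h : ℂ → ℝ} (hh : IsTestFun h)
include hh

theorem differentiableAt (z : ℂ) : DifferentiableAt ℝ h z :=
  (hh.smooth.differentiable (by simp)).differentiableAt

theorem contDiff_planeHamVec : ContDiff ℝ 1 (planeHamVec h) := by
  have h1 : ContDiff ℝ 1 (fderiv ℝ h) := hh.smooth.fderiv_right (by norm_cast)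
  rw [planeHamVec_eq]
  exact (((h1.clm_apply contDiff_const).neg).smul contDiff_const).add
    ((h1.clm_apply contDiff_const).smul contDiff_const)

theorem hasCompactSupport_planeHamVec : HasCompactSupport (planeHamVec h) :=
  hh.compact.mono' fun z hz => by
    by_contra H
    exact hz (planeHamVec_eq_zero_of_notMem_tsupport H)

theorem exists_lipschitz : ∃ K, LipschitzWith K (planeHamVec h) :=
  hh.contDiff_planeHamVec.lipschitzWith_of_hasCompactSupport hh.hasCompactSupport_planeHamVec
    one_ne_zero

theorem planeFlow_spec : (∀ z, planeFlow h 0 z = z) ∧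
    ∀ z t, HasDerivAt (fun s => planeFlow h s z) (planeHamVec h (planeFlow h t z)) t := by
  obtain ⟨K, hK⟩ := hh.exists_lipschitz
  obtain ⟨C, hC⟩ := hh.hasCompactSupport_planeHamVec.exists_bound_of_continuous
    hh.contDiff_planeHamVec.continuous
  have H := exists_globalFlow (M := C.toNNReal) hK fun x => (hC x).trans (Real.le_coe_toNNReal C)
  rw [planeFlow, dif_pos H]
  exact H.choose_spec

theorem planeFlow_zero (z : ℂ) : planeFlow h 0 z = z := hh.planeFlow_spec.1 z

theorem hasDerivAt_planeFlow (z : ℂ) (t : ℝ) :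
    HasDerivAt (fun s => planeFlow h s z) (planeHamVec h (planeFlow h t z)) t :=
  hh.planeFlow_spec.2 z t

theorem eq_planeFlow {γ : ℝ → ℂ} (hγ : ∀ t, HasDerivAt γ (planeHamVec h (γ t)) t) (t : ℝ) :
    γ t = planeFlow h t (γ 0) := by
  obtain ⟨K, hK⟩ := hh.exists_lipschitz
  exact congrFun (ODE_solution_unique_univ (v := fun _ => planeHamVec h) (s := fun _ => univ)
    (t₀ := 0) (fun _ => hK.lipschitzOnWith) (fun t => ⟨hγ t, trivial⟩)
    (fun t => ⟨hh.hasDerivAt_planeFlow (γ 0) t, trivial⟩) (hh.planeFlow_zero _).symm) t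

/-- A solution on `[0,1]` of the Hamiltonian equation sped up by a factor `c` is a piece of
trajectory of the flow. -/
theorem eq_planeFlow_of_Icc {γ : ℝ → ℂ} (c : ℝ)
    (hγ : ∀ t ∈ Icc (0 : ℝ) 1, HasDerivWithinAt γ (c • planeHamVec h (γ t)) (Icc 0 1) t)
    {t : ℝ} (ht : t ∈ Icc (0 : ℝ) 1) : γ t = planeFlow h (t * c) (γ 0) := by
  obtain ⟨K, hK⟩ := hh.exists_lipschitz
  have hd : ∀ t, HasDerivAt (fun s => planeFlow h (s * c) (γ 0))
      (c • planeHamVec h (planeFlow h (t * c) (γ 0))) t := fun t =>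
    HasDerivAt.scomp (h := fun s : ℝ => s * c) t (hh.hasDerivAt_planeFlow (γ 0) (t * c))
      (by simpa using (hasDerivAt_id t).mul_const c)
  refine ODE_solution_unique (v := fun _ => c • planeHamVec h) (K := ‖c‖₊ * K)
    (fun _ => (lipschitzWith_smul c).comp hK) (fun t ht => (hγ t ht).continuousWithinAt) ?_
    (fun t _ => (hd t).continuousAt.continuousWithinAt)
    (fun t _ => (hd t).hasDerivWithinAt) (by simp [hh.planeFlow_zero]) ht
  exact fun t ht => (hγ t (Ico_subset_Icc_self ht)).mono_of_mem_nhdsWithin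
    (Icc_mem_nhdsGE_of_mem ht)

theorem planeFlow_add (s t : ℝ) (z : ℂ) :
    planeFlow h (s + t) z = planeFlow h s (planeFlow h t z) := by
  have := hh.eq_planeFlow (γ := fun s => planeFlow h (s + t) z)
    (fun s => (hh.hasDerivAt_planeFlow z (s + t)).comp_add_const s t) s
  simpa using this

theorem planeFlow_eq_self {z : ℂ} (hz : planeHamVec h z = 0) (t : ℝ) : planeFlow h t z = z :=
  (hh.eq_planeFlow (γ := fun _ => z) (fun t => by rw [hz]; exact hasDerivAt_const t z) t).symm

theorem planeFlow_mem_tsupport {z : ℂ} (hz : z ∈ tsupport h) (t : ℝ) :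
    planeFlow h t z ∈ tsupport h := by
  by_contra H
  have h1 := hh.planeFlow_eq_self (planeHamVec_eq_zero_of_notMem_tsupport H) (-t)
  rw [← hh.planeFlow_add, neg_add_cancel, hh.planeFlow_zero] at h1
  exact H (h1 ▸ hz)

/-- Conservation of energy. -/
theorem apply_planeFlow (z : ℂ) (t : ℝ) : h (planeFlow h t z) = h z := by
  have hd : ∀ t, HasDerivAt (fun s => h (planeFlow h s z)) 0 t := fun t => by
    have := (hh.differentiableAt (planeFlow h t z)).hasFDerivAt.comp_hasDerivAt t
      (hh.hasDerivAt_planeFlow z t)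
    rw [fderiv_apply_eq] at this
    exact this.congr_deriv (by simp only [planeHamVec]; ring)
  have := is_const_of_deriv_eq_zero (fun t => (hd t).differentiableAt) (fun t => (hd t).deriv) t 0
  rwa [hh.planeFlow_zero] at this

theorem continuous_planeFlow {t : ℝ} (ht : 0 ≤ t) : Continuous (planeFlow h t) := by
  obtain ⟨K, hK⟩ := hh.exists_lipschitz
  refine LipschitzWith.continuous (K := (Real.exp (K * (t - 0))).toNNReal) ?_
  refine LipschitzWith.of_dist_le_mul fun x y => ?_
  have hc : ∀ x, ContinuousOn (fun s => planeFlow h s x) (Icc 0 t) := fun x s _ =>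
    (hh.hasDerivAt_planeFlow x s).continuousAt.continuousWithinAt
  have := dist_le_of_trajectories_ODE (v := fun _ => planeHamVec h) (δ := dist x y) (fun _ => hK)
    (hc x) (fun s _ => (hh.hasDerivAt_planeFlow x s).hasDerivWithinAt) (hc y)
    (fun s _ => (hh.hasDerivAt_planeFlow y s).hasDerivWithinAt)
    (by rw [hh.planeFlow_zero, hh.planeFlow_zero]) t ⟨ht, le_rfl⟩
  rw [Real.coe_toNNReal _ (Real.exp_pos _).le]
  linarith

/-- The flow of a Hamiltonian that is odd under complex conjugation commutes with it, so it
preserves the complement of the real axis. -/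
theorem im_planeFlow_ne_zero (hodd : ∀ z, h (starRingEnd ℂ z) = -h z) {z : ℂ} (hz : z.im ≠ 0)
    (t : ℝ) : (planeFlow h t z).im ≠ 0 := by
  have hX : ∀ z, planeHamVec h (starRingEnd ℂ z) = starRingEnd ℂ (planeHamVec h z) := by
    intro z
    have h1 : HasFDerivAt (fun z => h (starRingEnd ℂ z))
        ((fderiv ℝ h (starRingEnd ℂ z)).comp (Complex.conjCLE : ℂ →L[ℝ] ℂ)) z :=
      HasFDerivAt.comp z (g := h) (f := fun z => starRingEnd ℂ z)
        (hh.differentiableAt _).hasFDerivAt Complex.conjCLE.hasFDerivAt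
    have h2 : HasFDerivAt (fun z => h (starRingEnd ℂ z)) (-fderiv ℝ h z) z := by
      simp only [hodd]
      exact (hh.differentiableAt z).hasFDerivAt.neg
    have h3 := h1.unique h2
    have e1 := congrArg (fun L => L (1 : ℂ)) h3
    have eI := congrArg (fun L => L Complex.I) h3
    simp at e1 eI
    apply Complex.ext
    · simp [planeHamVec, eI]
    · simp [planeHamVec, e1]
  have hconj : ∀ w s, planeFlow h s (starRingEnd ℂ w) = starRingEnd ℂ (planeFlow h s w) := by
    intro w s
    have := hh.eq_planeFlow (γ := fun s => starRingEnd ℂ (planeFlow h s w)) (fun s => by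
      rw [hX]
      exact (Complex.conjCLE : ℂ →L[ℝ] ℂ).hasFDerivAt.comp_hasDerivAt s
        (hh.hasDerivAt_planeFlow w s)) s
    simpa [hh.planeFlow_zero] using this.symm
  intro H
  apply hz
  have h1 := hconj (planeFlow h t z) (-t)
  rw [Complex.conj_eq_iff_im.2 H, ← hh.planeFlow_add, neg_add_cancel, hh.planeFlow_zero] at h1
  exact Complex.conj_eq_iff_im.1 h1.symm

end IsTestFun

/-! ### Hamiltonian isotopies of `ℂ²` with product Hamiltonians -/

theorem omegaStd_smul (c : ℝ) (X v : ℂ × ℂ) : omegaStd (c • X) v = c * omegaStd X v := by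
  simp [omegaStd]; ring

/-- The pairs `(φ^f_{t g(w)}(z), φ^g_{t f(z)}(w))`, which form the flow of the Hamiltonian
`f(z) g(w)`, because `f` and `g` are conserved. -/
noncomputable def productFlow (f g : ℂ → ℝ) (t : ℝ) (p : ℂ × ℂ) : ℂ × ℂ :=
  (planeFlow f (t * g p.2) p.1, planeFlow g (t * f p.1) p.2)

theorem isHamiltonianFlow_productFlow {f g : ℂ → ℝ} (hf : IsTestFun f) (hg : IsTestFun g) :
    IsHamiltonianFlow (productFlow f g) := by
  refine ⟨fun _ p => f p.1 * g p.2, ?_, ⟨tsupport f ×ˢ tsupport g,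
    hf.compact.isCompact.prod hg.compact.isCompact, ?_⟩, ?_, ?_⟩
  · exact ((hf.smooth.comp (contDiff_fst.comp contDiff_snd)).mul
      (hg.smooth.comp (contDiff_snd.comp contDiff_snd))).contDiffOn
  · intro t _ p hp
    by_contra H
    rcases mul_ne_zero_iff.1 H with ⟨h1, h2⟩
    exact hp ⟨subset_tsupport f h1, subset_tsupport g h2⟩
  · intro p
    simp [productFlow, hf.planeFlow_zero, hg.planeFlow_zero]
  · intro p t _
    set z := planeFlow f (t * g p.2) p.1 with hz
    set w := planeFlow g (t * f p.1) p.2 with hw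
    refine ⟨(g p.2 • planeHamVec f z, f p.1 • planeHamVec g w), ?_, ?_⟩
    · intro v
      have hd : HasFDerivAt (fun p : ℂ × ℂ => f p.1 * g p.2)
          (f z • (fderiv ℝ g w).comp (ContinuousLinearMap.snd ℝ ℂ ℂ) +
            g w • (fderiv ℝ f z).comp (ContinuousLinearMap.fst ℝ ℂ ℂ)) (z, w) :=
        HasFDerivAt.mul
          (HasFDerivAt.comp (g := f) (z, w) (hf.differentiableAt z).hasFDerivAt hasFDerivAt_fst)
          (HasFDerivAt.comp (g := g) (z, w) (hg.differentiableAt w).hasFDerivAt hasFDerivAt_snd)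
      have hfz : f z = f p.1 := hf.apply_planeFlow _ _
      have hgw : g w = g p.2 := hg.apply_planeFlow _ _
      change _ = -(fderiv ℝ (fun p : ℂ × ℂ => f p.1 * g p.2) (z, w) v)
      rw [hd.fderiv, hfz, hgw]
      simp only [add_apply, smul_apply, ContinuousLinearMap.comp_apply,
        ContinuousLinearMap.coe_fst', ContinuousLinearMap.coe_snd',
        smul_eq_mul]
      rw [fderiv_apply_eq f, fderiv_apply_eq g]
      simp only [omegaStd, planeHamVec, Complex.real_smul, Complex.mul_re, Complex.mul_im,
        Complex.ofReal_re, Complex.ofReal_im]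
      ring
    · have h1 : HasDerivAt (fun s => planeFlow f (s * g p.2) p.1) (g p.2 • planeHamVec f z) t :=
        HasDerivAt.scomp (h := fun s : ℝ => s * g p.2) t (hf.hasDerivAt_planeFlow p.1 (t * g p.2))
          (by simpa using (hasDerivAt_id t).mul_const (g p.2))
      have h2 : HasDerivAt (fun s => planeFlow g (s * f p.1) p.2) (f p.1 • planeHamVec g w) t :=
        HasDerivAt.scomp (h := fun s : ℝ => s * f p.1) t (hg.hasDerivAt_planeFlow p.2 (t * f p.1))
          (by simpa using (hasDerivAt_id t).mul_const (f p.1))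
      exact (h1.prodMk h2).hasDerivWithinAt

/-- Some Hamiltonian isotopy moves `L` inside `V` to a subset of `L'`. -/
def Movable (V L L' : Set (ℂ × ℂ)) : Prop :=
  ∃ φ : ℝ → ℂ × ℂ → ℂ × ℂ, IsHamiltonianFlow φ ∧ (∀ t ∈ Icc (0 : ℝ) 1, ∀ p ∈ L, φ t p ∈ V) ∧
    ∀ p ∈ L, φ 1 p ∈ L'

theorem deriv_eq_zero_of_extremal {β : ℝ → ℝ} (hβ : ∀ t, β t ∈ Icc (0 : ℝ) 1) {t : ℝ}
    (h : β t = 0 ∨ β t = 1) : deriv β t = 0 := by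
  rcases h with h | h
  · exact IsLocalMin.deriv_eq_zero (Filter.Eventually.of_forall fun s => h ▸ (hβ s).1)
  · exact IsLocalMax.deriv_eq_zero (Filter.Eventually.of_forall fun s => h ▸ (hβ s).2)

/-- Hamiltonian isotopies can be concatenated: run the first one while a cutoff `β₁` increases
from `0` to `1`, then the second one while a cutoff `β₂` does so. -/
theorem IsHamiltonianFlow.concat {φ ψ : ℝ → ℂ × ℂ → ℂ × ℂ} (hφ : IsHamiltonianFlow φ)
    (hψ : IsHamiltonianFlow ψ) : ∃ χ : ℝ → ℂ × ℂ → ℂ × ℂ, IsHamiltonianFlow χ ∧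
      (∀ t ∈ Icc (0 : ℝ) 1, (∃ s ∈ Icc (0 : ℝ) 1, χ t = φ s) ∨
        ∃ s ∈ Icc (0 : ℝ) 1, ∀ p, χ t p = ψ s (φ 1 p)) ∧ ∀ p, χ 1 p = ψ 1 (φ 1 p) := by
  obtain ⟨H₁, hH₁, ⟨K₁, hK₁, hz₁⟩, h0₁, hd₁⟩ := hφ
  obtain ⟨H₂, hH₂, ⟨K₂, hK₂, hz₂⟩, h0₂, hd₂⟩ := hψ
  set β₁ : ℝ → ℝ := fun t => Real.smoothTransition (3 * t) with hβ₁
  set β₂ : ℝ → ℝ := fun t => Real.smoothTransition (3 * t - 2) with hβ₂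
  have m₁ : ∀ t, β₁ t ∈ Icc (0 : ℝ) 1 := fun t =>
    ⟨Real.smoothTransition.nonneg _, Real.smoothTransition.le_one _⟩
  have m₂ : ∀ t, β₂ t ∈ Icc (0 : ℝ) 1 := fun t =>
    ⟨Real.smoothTransition.nonneg _, Real.smoothTransition.le_one _⟩
  have s₁ : ContDiff ℝ ∞ β₁ := Real.smoothTransition.contDiff.comp (contDiff_const.mul contDiff_id)
  have s₂ : ContDiff ℝ ∞ β₂ :=
    Real.smoothTransition.contDiff.comp ((contDiff_const.mul contDiff_id).sub contDiff_const)
  have o₁ : ∀ t : ℝ, 1 / 3 ≤ t → β₁ t = 1 := fun t ht =>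
    Real.smoothTransition.one_of_one_le (by linarith)
  have z₂ : ∀ t : ℝ, t ≤ 2 / 3 → β₂ t = 0 := fun t ht =>
    Real.smoothTransition.zero_of_nonpos (by linarith)
  have o₂ : β₂ 1 = 1 := Real.smoothTransition.one_of_one_le (by norm_num)
  have z₁ : β₁ 0 = 0 := Real.smoothTransition.zero_of_nonpos (by norm_num)
  have d₁ : ∀ t, HasDerivAt β₁ (deriv β₁ t) t := fun t =>
    (s₁.differentiable (by simp)).differentiableAt.hasDerivAt
  have d₂ : ∀ t, HasDerivAt β₂ (deriv β₂ t) t := fun t =>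
    (s₂.differentiable (by simp)).differentiableAt.hasDerivAt
  have main : ∀ (β : ℝ → ℝ) (_ : ∀ t, β t ∈ Icc (0 : ℝ) 1) (_ : ∀ t, HasDerivAt β (deriv β t) t)
      (ξ : ℝ → ℂ × ℂ → ℂ × ℂ) (H : ℝ → ℂ × ℂ → ℝ)
      (_ : ∀ p, ∀ t ∈ Icc (0 : ℝ) 1, ∃ X : ℂ × ℂ, IsHamiltonianVectorAt (H t) (ξ t p) X ∧
        HasDerivWithinAt (fun s => ξ s p) X (Icc (0 : ℝ) 1) t) (p : ℂ × ℂ) (t : ℝ),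
      ∃ X : ℂ × ℂ, IsHamiltonianVectorAt (fun q => deriv β t * H (β t) q) (ξ (β t) p) X ∧
        HasDerivWithinAt (fun s => ξ (β s) p) X (Icc (0 : ℝ) 1) t := by
    intro β mβ dβ ξ H hd p t
    obtain ⟨X, hX, hX'⟩ := hd p (β t) (mβ t)
    refine ⟨deriv β t • X, fun v => ?_, ?_⟩
    · rw [omegaStd_smul, hX v]
      have : fderiv ℝ (fun q => deriv β t * H (β t) q) (ξ (β t) p) =
          deriv β t • fderiv ℝ (H (β t)) (ξ (β t) p) :=
        congrFun (fderiv_const_smul_field (deriv β t) (f := H (β t))) _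
      rw [this]; simp
    · exact HasDerivWithinAt.scomp (h := β) t hX' (dβ t).hasDerivWithinAt fun s _ => mβ s
  refine ⟨fun t p => ψ (β₂ t) (φ (β₁ t) p),
    ⟨fun t p => deriv β₁ t * H₁ (β₁ t) p + deriv β₂ t * H₂ (β₂ t) p, ?_, ?_, ?_, ?_⟩, ?_, ?_⟩
  · have c₁ : ContDiff ℝ ∞ (deriv β₁) := (contDiff_infty_iff_deriv.1 s₁).2
    have c₂ : ContDiff ℝ ∞ (deriv β₂) := (contDiff_infty_iff_deriv.1 s₂).2
    have e : ∀ (β : ℝ → ℝ) (_ : ∀ t, β t ∈ Icc (0 : ℝ) 1) (_ : ContDiff ℝ ∞ β)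
        (_ : ContDiff ℝ ∞ (deriv β)) (H : ℝ → ℂ × ℂ → ℝ)
        (_ : ContDiffOn ℝ ∞ (fun x : ℝ × (ℂ × ℂ) => H x.1 x.2) (Icc (0 : ℝ) 1 ×ˢ univ)),
        ContDiff ℝ ∞ (fun x : ℝ × (ℂ × ℂ) => deriv β x.1 * H (β x.1) x.2) := by
      intro β mβ sβ cβ H hH
      refine (cβ.comp contDiff_fst).mul ?_
      rw [← contDiffOn_univ]
      exact hH.comp (t := Icc (0 : ℝ) 1 ×ˢ univ) (f := fun x : ℝ × (ℂ × ℂ) => (β x.1, x.2))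
        ((sβ.comp contDiff_fst).prodMk contDiff_snd).contDiffOn
        (fun x _ => ⟨mβ x.1, trivial⟩)
    exact ((e β₁ m₁ s₁ c₁ H₁ hH₁).add (e β₂ m₂ s₂ c₂ H₂ hH₂)).contDiffOn
  · refine ⟨K₁ ∪ K₂, hK₁.union hK₂, fun t _ p hp => ?_⟩
    rw [mem_union, not_or] at hp
    simp only [hz₁ _ (m₁ t) p hp.1, hz₂ _ (m₂ t) p hp.2, mul_zero, add_zero]
  · intro p
    simp only [z₁, z₂ 0 (by norm_num), h0₁, h0₂]
  · intro p t _
    rcases le_total t (1 / 2) with h | h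
    · obtain ⟨X, hX, hX'⟩ := main β₁ m₁ d₁ φ H₁ hd₁ p t
      have e0 : deriv β₂ t = 0 := deriv_eq_zero_of_extremal m₂ (Or.inl (z₂ t (by linarith)))
      have e1 : (fun s => ψ (β₂ s) (φ (β₁ s) p)) =ᶠ[nhdsWithin t (Icc 0 1)]
          fun s => φ (β₁ s) p := by
        filter_upwards [mem_nhdsWithin_of_mem_nhds (Iio_mem_nhds (show t < 2 / 3 by linarith))]
          with s hs
        rw [z₂ s (le_of_lt hs), h0₂]
      refine ⟨X, ?_, hX'.congr_of_eventuallyEq e1 (by simp only [z₂ t (by linarith), h0₂])⟩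
      simpa only [e0, zero_mul, add_zero, z₂ t (by linarith), h0₂] using hX
    · obtain ⟨X, hX, hX'⟩ := main β₂ m₂ d₂ ψ H₂ hd₂ (φ 1 p) t
      have e0 : deriv β₁ t = 0 := deriv_eq_zero_of_extremal m₁ (Or.inr (o₁ t (by linarith)))
      have e1 : (fun s => ψ (β₂ s) (φ (β₁ s) p)) =ᶠ[nhdsWithin t (Icc 0 1)]
          fun s => ψ (β₂ s) (φ 1 p) := by
        filter_upwards [mem_nhdsWithin_of_mem_nhds (Ioi_mem_nhds (show 1 / 3 < t by linarith))]
          with s hs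
        rw [o₁ s (le_of_lt hs)]
      refine ⟨X, ?_, hX'.congr_of_eventuallyEq e1 (by simp only [o₁ t (by linarith)])⟩
      simpa only [e0, zero_mul, zero_add, o₁ t (by linarith)] using hX
  · intro t _
    rcases le_total t (1 / 2) with h | h
    · exact Or.inl ⟨β₁ t, m₁ t, by ext1 p; simp only [z₂ t (by linarith), h0₂]⟩
    · exact Or.inr ⟨β₂ t, m₂ t, fun p => by simp only [o₁ t (by linarith)]⟩
  · intro p
    simp only [o₁ 1 (by norm_num), o₂]

theorem Movable.trans {V L₁ L₂ L₃ : Set (ℂ × ℂ)} (h₁ : Movable V L₁ L₂) (h₂ : Movable V L₂ L₃) :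
    Movable V L₁ L₃ := by
  obtain ⟨φ, hφ, hφV, hφ1⟩ := h₁
  obtain ⟨ψ, hψ, hψV, hψ1⟩ := h₂
  obtain ⟨χ, hχ, hχt, hχ1⟩ := hφ.concat hψ
  refine ⟨χ, hχ, fun t ht p hp => ?_, fun p hp => by rw [hχ1]; exact hψ1 _ (hφ1 p hp)⟩
  rcases hχt t ht with ⟨s, hs, h⟩ | ⟨s, hs, h⟩
  · rw [h]; exact hφV s hs p hp
  · rw [h]; exact hψV s hs _ (hφ1 p hp)

/-- To verify `Movable` for a product Hamiltonian `f(z) g(w)` it is enough to exhibit the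
trajectory of every point. -/
theorem movable_of_trajectories {V L L' : Set (ℂ × ℂ)} {f g : ℂ → ℝ} (hf : IsTestFun f)
    (hg : IsTestFun g)
    (H : ∀ p ∈ L, ∃ γ₁ γ₂ : ℝ → ℂ, γ₁ 0 = p.1 ∧ γ₂ 0 = p.2 ∧
      (∀ t ∈ Icc (0 : ℝ) 1,
        HasDerivWithinAt γ₁ (g p.2 • planeHamVec f (γ₁ t)) (Icc 0 1) t ∧
        HasDerivWithinAt γ₂ (f p.1 • planeHamVec g (γ₂ t)) (Icc 0 1) t ∧ (γ₁ t, γ₂ t) ∈ V) ∧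
      (γ₁ 1, γ₂ 1) ∈ L') : Movable V L L' := by
  have key : ∀ p ∈ L, (∀ t ∈ Icc (0 : ℝ) 1, productFlow f g t p ∈ V) ∧
      productFlow f g 1 p ∈ L' := by
    intro p hp
    obtain ⟨γ₁, γ₂, h1, h2, h3, h4⟩ := H p hp
    have e : ∀ t ∈ Icc (0 : ℝ) 1, productFlow f g t p = (γ₁ t, γ₂ t) := by
      intro t ht
      have e1 := hf.eq_planeFlow_of_Icc _ (fun t ht => (h3 t ht).1) ht
      have e2 := hg.eq_planeFlow_of_Icc _ (fun t ht => (h3 t ht).2.1) ht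
      rw [productFlow, e1, e2, h1, h2]
    exact ⟨fun t ht => by rw [e t ht]; exact (h3 t ht).2.2,
      by rw [e 1 ⟨zero_le_one, le_rfl⟩]; exact h4⟩
  exact ⟨productFlow f g, isHamiltonianFlow_productFlow hf hg, fun t ht p hp => (key p hp).1 t ht,
    fun p hp => (key p hp).2⟩

theorem exists_isTestFun_eq_one (r : ℝ) :
    ∃ g, IsTestFun g ∧ ∀ w, ‖w‖ ≤ r → g w = 1 ∧ planeHamVec g w = 0 := by
  let b : ContDiffBump (0 : ℂ) := ⟨|r| + 1, |r| + 2, by positivity, by linarith⟩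
  refine ⟨b, ⟨b.contDiff, b.hasCompactSupport⟩, fun w hw => ?_⟩
  have hw' : w ∈ Metric.ball (0 : ℂ) b.rIn := by
    rw [mem_ball_zero_iff]
    change _ < |r| + 1
    linarith [le_abs_self r]
  refine ⟨b.one_of_mem_closedBall (Metric.ball_subset_closedBall hw'), ?_⟩
  rw [planeHamVec_congr (b.eventuallyEq_one_of_mem_ball hw')]
  exact planeHamVec_const 1 w

theorem movable_fst {V L L' : Set (ℂ × ℂ)} {f : ℂ → ℝ} (hf : IsTestFun f) {r : ℝ}
    (hr : ∀ p ∈ L, ‖p.2‖ ≤ r) (hV : ∀ t ∈ Icc (0 : ℝ) 1, ∀ p ∈ L, (planeFlow f t p.1, p.2) ∈ V)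
    (hL : ∀ p ∈ L, (planeFlow f 1 p.1, p.2) ∈ L') : Movable V L L' := by
  obtain ⟨g, hg, hg1⟩ := exists_isTestFun_eq_one r
  refine movable_of_trajectories hf hg fun p hp => ⟨fun t => planeFlow f t p.1, fun _ => p.2,
    hf.planeFlow_zero _, rfl, fun t ht => ⟨?_, ?_, hV t ht p hp⟩, hL p hp⟩
  · rw [(hg1 _ (hr p hp)).1, one_smul]
    exact (hf.hasDerivAt_planeFlow _ _).hasDerivWithinAt
  · rw [(hg1 _ (hr p hp)).2, smul_zero]
    exact hasDerivWithinAt_const _ _ _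

theorem movable_snd {V L L' : Set (ℂ × ℂ)} {g : ℂ → ℝ} (hg : IsTestFun g) {r : ℝ}
    (hr : ∀ p ∈ L, ‖p.1‖ ≤ r) (hV : ∀ t ∈ Icc (0 : ℝ) 1, ∀ p ∈ L, (p.1, planeFlow g t p.2) ∈ V)
    (hL : ∀ p ∈ L, (p.1, planeFlow g 1 p.2) ∈ L') : Movable V L L' := by
  obtain ⟨f, hf, hf1⟩ := exists_isTestFun_eq_one r
  refine movable_of_trajectories hf hg fun p hp => ⟨fun _ => p.1, fun t => planeFlow g t p.2,
    rfl, hg.planeFlow_zero _, fun t ht => ⟨?_, ?_, hV t ht p hp⟩, hL p hp⟩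
  · rw [(hf1 _ (hr p hp)).2, smul_zero]
    exact hasDerivWithinAt_const _ _ _
  · rw [(hf1 _ (hr p hp)).1, one_smul]
    exact (hg.hasDerivAt_planeFlow _ _).hasDerivWithinAt

theorem Movable.exists_isHamiltonianIsotopy {V L L' : Set (ℂ × ℂ)} (h : Movable V L L') :
    ∃ T : ℝ → Set (ℂ × ℂ), IsHamiltonianIsotopy T ∧ T 0 = L ∧ (∀ t ∈ Icc (0 : ℝ) 1, T t ⊆ V) ∧
      T 1 ⊆ L' := by
  obtain ⟨φ, hφ, hV, h1⟩ := h
  have h0 : φ 0 '' L = L := by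
    obtain ⟨_, _, _, h0, _⟩ := hφ
    simp [image_congr fun p _ => h0 p]
  refine ⟨fun t => φ t '' L, ⟨φ, hφ, fun t _ => by simp only [h0]⟩, h0, fun t ht => ?_, ?_⟩
  · exact image_subset_iff.2 fun p hp => hV t ht p hp
  · exact image_subset_iff.2 fun p hp => h1 p hp

theorem isTestFun_zero : IsTestFun (fun _ => 0) := ⟨contDiff_const, HasCompactSupport.zero⟩

theorem Movable.of_subset {V L L' : Set (ℂ × ℂ)} (h : L ⊆ V) (h' : L ⊆ L') : Movable V L L' :=
  movable_of_trajectories isTestFun_zero isTestFun_zero fun p hp => ⟨fun _ => p.1, fun _ => p.2,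
    rfl, rfl, fun t _ => ⟨by simpa using hasDerivWithinAt_const _ _ _,
      by simpa using hasDerivWithinAt_const _ _ _, h hp⟩, h' hp⟩

/-! ### Cutoff functions -/

/-- A smooth monotone step from `0` on `(-∞, lo]` to `1` on `[hi, ∞)`. -/
noncomputable def smoothStep (lo hi x : ℝ) : ℝ := Real.smoothTransition ((x - lo) / (hi - lo))

section smoothStep

variable {lo hi x : ℝ}

theorem smoothStep_nonneg : 0 ≤ smoothStep lo hi x := Real.smoothTransition.nonneg _

theorem smoothStep_le_one : smoothStep lo hi x ≤ 1 := Real.smoothTransition.le_one _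

theorem smoothStep_of_le (h : lo < hi) (hx : x ≤ lo) : smoothStep lo hi x = 0 :=
  Real.smoothTransition.zero_of_nonpos
    (div_nonpos_of_nonpos_of_nonneg (by linarith) (by linarith))

theorem smoothStep_of_ge (h : lo < hi) (hx : hi ≤ x) : smoothStep lo hi x = 1 :=
  Real.smoothTransition.one_of_one_le ((one_le_div (by linarith)).2 (by linarith))

theorem contDiff_smoothStep : ContDiff ℝ ∞ (smoothStep lo hi) :=
  Real.smoothTransition.contDiff.comp ((contDiff_id.sub contDiff_const).div_const _)

end smoothStep

/-- Smooth plateau functions: `1` near a compact set, supported in a given neighbourhood. -/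
theorem exists_isTestFun_one_near {K O : Set ℂ} (hK : IsCompact K) (hO : IsOpen O) (hKO : K ⊆ O) :
    ∃ B, IsTestFun B ∧ tsupport B ⊆ O ∧ ∀ z ∈ K, B =ᶠ[nhds z] fun _ => 1 := by
  obtain ⟨K', hK', h1, h2⟩ := exists_compact_between hK hO hKO
  obtain ⟨B, hB1, hB0, -⟩ := exists_contMDiffMap_one_nhds_of_subset_interior
    (modelWithCornersSelf ℝ ℂ) (n := ⊤) hK.isClosed h1
  have hs : tsupport B ⊆ K' := closure_minimal (fun z hz => by
    by_contra H
    exact hz (hB0 z H)) hK'.isClosed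
  refine ⟨B, ⟨B.contMDiff.contDiff, hK'.of_isClosed_subset (isClosed_tsupport _) hs⟩,
    hs.trans h2, fun z hz => ?_⟩
  exact Filter.Eventually.filter_mono (nhds_le_nhdsSet hz) hB1

/-- A function which is smooth on an open set agrees near a given compact subset with a smooth
function of compact support. -/
theorem exists_isTestFun_eq_near {K O : Set ℂ} {f : ℂ → ℝ} (hf : ContDiffOn ℝ ∞ f O)
    (hK : IsCompact K) (hO : IsOpen O) (hKO : K ⊆ O) :
    ∃ g, IsTestFun g ∧ ∀ z ∈ K, g =ᶠ[nhds z] f := by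
  obtain ⟨B, hB, hBO, hB1⟩ := exists_isTestFun_one_near hK hO hKO
  refine ⟨fun z => B z * f z, ⟨?_, hB.compact.mul_right⟩, fun z hz => ?_⟩
  · rw [contDiff_iff_contDiffAt]
    intro z
    by_cases hz : z ∈ tsupport B
    · exact hB.smooth.contDiffAt.mul ((hf z (hBO hz)).contDiffAt (hO.mem_nhds (hBO hz)))
    · refine (contDiffAt_const (c := (0 : ℝ))).congr_of_eventuallyEq ?_
      filter_upwards [notMem_tsupport_iff_eventuallyEq.1 hz] with w hw
      rw [hw]; simp
  · filter_upwards [hB1 z hz] with w hw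
    rw [hw, one_mul]

/-! ### Area-angle coordinates -/

/-- The area `π|w|²` of the disc centred at the origin with `w` on its boundary. -/
noncomputable def area (w : ℂ) : ℝ := Real.pi * ‖w‖ ^ 2

/-- The point at area `u` and angle `v`. Angles are measured in full turns and start at the
negative real axis, so that `0 < v < 1` describes the slit plane. -/
noncomputable def pol (u v : ℝ) : ℂ :=
  -(Real.sqrt (u / Real.pi) : ℂ) * Complex.exp ((2 * Real.pi * v : ℝ) * Complex.I)

/-- The angular coordinate on the slit plane, with values in `(0, 1)`. -/
noncomputable def turn (w : ℂ) : ℝ := Complex.arg w / (2 * Real.pi) + 1 / 2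

/-- The angular coordinate cut along the positive real axis, with values in `(-1/2, 1/2]`. -/
noncomputable def turnNeg (w : ℂ) : ℝ := Complex.arg (-w) / (2 * Real.pi)

theorem area_nonneg (w : ℂ) : 0 ≤ area w := by unfold area; positivity

theorem area_pos {w : ℂ} : 0 < area w ↔ w ≠ 0 := by
  unfold area
  have := Real.pi_pos
  constructor
  · rintro h rfl; simp at h
  · intro h; positivity

theorem norm_pol (u v : ℝ) : ‖pol u v‖ = Real.sqrt (u / Real.pi) := by
  rw [pol, norm_mul, norm_neg, Complex.norm_exp_ofReal_mul_I, mul_one, Complex.norm_real,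
    Real.norm_of_nonneg (Real.sqrt_nonneg _)]

theorem area_pol {u : ℝ} (hu : 0 ≤ u) (v : ℝ) : area (pol u v) = u := by
  have := Real.pi_pos
  rw [area, norm_pol, Real.sq_sqrt (by positivity)]
  field_simp

theorem norm_eq_sqrt_area (w : ℂ) : ‖w‖ = Real.sqrt (area w / Real.pi) := by
  have := Real.pi_pos
  rw [area, mul_div_cancel_left₀ _ this.ne', Real.sqrt_sq (norm_nonneg _)]

theorem pol_ne_zero {u : ℝ} (hu : 0 < u) (v : ℝ) : pol u v ≠ 0 :=
  area_pos.1 (by rw [area_pol hu.le]; exact hu)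

theorem pol_add_one (u v : ℝ) : pol u (v + 1) = pol u v := by
  have : ((2 * Real.pi * (v + 1) : ℝ) * Complex.I : ℂ) =
      (2 * Real.pi * v : ℝ) * Complex.I + 2 * Real.pi * Complex.I := by push_cast; ring
  rw [pol, pol, this, Complex.exp_periodic]

theorem pol_area_turnNeg (w : ℂ) : pol (area w) (turnNeg w) = w := by
  have h := Complex.norm_mul_exp_arg_mul_I (-w)
  have h2 : (2 * Real.pi * turnNeg w : ℝ) = Complex.arg (-w) := by
    rw [turnNeg]; have := Real.pi_pos; field_simp
  rw [pol, h2, ← norm_eq_sqrt_area, neg_mul, ← norm_neg w, h, neg_neg]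

theorem pol_eq (u v : ℝ) : pol u v =
    (Real.sqrt (u / Real.pi) : ℂ) * Complex.exp ((2 * Real.pi * (v - 1 / 2) : ℝ) * Complex.I) := by
  have : ((2 * Real.pi * v : ℝ) * Complex.I : ℂ) =
      (2 * Real.pi * (v - 1 / 2) : ℝ) * Complex.I + Real.pi * Complex.I := by push_cast; ring
  rw [pol, this, Complex.exp_add, Complex.exp_pi_mul_I]; ring

theorem pol_area_turn (w : ℂ) : pol (area w) (turn w) = w := by
  have h := Complex.norm_mul_exp_arg_mul_I w
  have h2 : (2 * Real.pi * (turn w - 1 / 2) : ℝ) = Complex.arg w := by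
    rw [turn]; have := Real.pi_pos; field_simp; ring
  rw [pol_eq, h2, ← norm_eq_sqrt_area, h]

theorem arg_mul_exp {r θ : ℝ} (hr : 0 < r) (h0 : -Real.pi < θ) (h1 : θ ≤ Real.pi) :
    Complex.arg ((r : ℂ) * Complex.exp ((θ : ℝ) * Complex.I)) = θ := by
  rw [Complex.exp_mul_I, Complex.arg_mul_cos_add_sin_mul_I hr ⟨h0, h1⟩]

theorem turn_pol {u v : ℝ} (hu : 0 < u) (h0 : 0 < v) (h1 : v ≤ 1) : turn (pol u v) = v := by
  have := Real.pi_pos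
  rw [turn, pol_eq, arg_mul_exp (Real.sqrt_pos.2 (by positivity)) (by nlinarith) (by nlinarith)]
  field_simp; ring

theorem turnNeg_pol {u v : ℝ} (hu : 0 < u) (h0 : -(1 / 2) < v) (h1 : v ≤ 1 / 2) :
    turnNeg (pol u v) = v := by
  have := Real.pi_pos
  rw [turnNeg, pol, neg_mul, neg_neg, arg_mul_exp (Real.sqrt_pos.2 (by positivity))
    (by nlinarith) (by nlinarith)]
  field_simp

theorem turnNeg_mem (w : ℂ) : turnNeg w ∈ Ioc (-(1 / 2) : ℝ) (1 / 2) := by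
  have := Real.pi_pos
  have h1 := Complex.neg_pi_lt_arg (-w)
  have h2 := Complex.arg_le_pi (-w)
  rw [turnNeg]
  constructor
  · rw [lt_div_iff₀ (by positivity)]; linarith
  · rw [div_le_iff₀ (by positivity)]; linarith

theorem mem_slitPlane_iff_turn {w : ℂ} : w ∈ Complex.slitPlane ↔ turn w < 1 ∧ w ≠ 0 := by
  have := Real.pi_pos
  have h2 := Complex.arg_le_pi w
  rw [Complex.mem_slitPlane_iff_arg, turn]
  refine and_congr ⟨fun h => ?_, fun h h' => ?_⟩ Iff.rfl
  · have : Complex.arg w < Real.pi := lt_of_le_of_ne h2 h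
    have : Complex.arg w / (2 * Real.pi) < 1 / 2 := by
      rw [div_lt_iff₀ (by positivity)]; linarith
    linarith
  · rw [h'] at h
    field_simp at h
    linarith

theorem turn_pos (w : ℂ) : 0 < turn w := by
  have := Real.pi_pos
  have h1 := Complex.neg_pi_lt_arg w
  have : -(1 / 2) < Complex.arg w / (2 * Real.pi) := by
    rw [lt_div_iff₀ (by positivity)]; linarith
  rw [turn]; linarith

theorem turn_mem {w : ℂ} (hw : w ∈ Complex.slitPlane) : turn w ∈ Ioo (0 : ℝ) 1 :=
  ⟨turn_pos w, (mem_slitPlane_iff_turn.1 hw).1⟩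

theorem area_pos_of_mem {w : ℂ} (hw : w ∈ Complex.slitPlane) : 0 < area w :=
  area_pos.2 (mem_slitPlane_iff_turn.1 hw).2

theorem pol_mem_slitPlane {u v : ℝ} (hu : 0 < u) (h0 : 0 < v) (h1 : v < 1) :
    pol u v ∈ Complex.slitPlane :=
  mem_slitPlane_iff_turn.2 ⟨by rwa [turn_pol hu h0 h1.le], pol_ne_zero hu v⟩

/-- The differential of any continuous branch of the angle, measured in full turns. -/
noncomputable def angleForm (z : ℂ) : ℂ →L[ℝ] ℝ :=
  (2 * Real.pi)⁻¹ • Complex.imCLM.comp (z⁻¹ • (1 : ℂ →L[ℝ] ℂ))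

theorem hasFDerivAt_arg {z : ℂ} (hz : z ∈ Complex.slitPlane) :
    HasFDerivAt Complex.arg (Complex.imCLM.comp (z⁻¹ • (1 : ℂ →L[ℝ] ℂ))) z := by
  have := Complex.imCLM.hasFDerivAt.comp z (Complex.hasStrictFDerivAt_log_real hz).hasFDerivAt
  refine this.congr_of_eventuallyEq (Filter.Eventually.of_forall fun w => ?_)
  simp [Complex.log_im]

theorem hasFDerivAt_turn {z : ℂ} (hz : z ∈ Complex.slitPlane) :
    HasFDerivAt turn (angleForm z) z := by
  have := ((hasFDerivAt_arg hz).const_smul (2 * Real.pi)⁻¹).add_const (1 / 2)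
  refine this.congr_of_eventuallyEq (Filter.Eventually.of_forall fun w => ?_)
  simp [turn]; ring

theorem hasFDerivAt_turnNeg {z : ℂ} (hz : -z ∈ Complex.slitPlane) :
    HasFDerivAt turnNeg (angleForm z) z := by
  have h1 := (hasFDerivAt_arg hz).comp z (hasFDerivAt_id z).neg
  have := h1.const_smul (2 * Real.pi)⁻¹
  refine (this.congr_fderiv ?_).congr_of_eventuallyEq (Filter.Eventually.of_forall fun w => ?_)
  · ext v; simp [angleForm, inv_neg]; ring
  · simp [turnNeg]; ring

theorem contDiff_area : ContDiff ℝ ∞ area := contDiff_const.mul (contDiff_norm_sq ℝ)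

theorem continuous_area : Continuous area := contDiff_area.continuous

theorem contDiffAt_arg {z : ℂ} (hz : z ∈ Complex.slitPlane) : ContDiffAt ℝ ∞ Complex.arg z := by
  have h1 : ContDiffAt ℝ ∞ Complex.log z := (Complex.contDiffAt_log hz).restrict_scalars ℝ
  refine (Complex.imCLM.contDiff.contDiffAt.comp z h1).congr_of_eventuallyEq
    (Filter.Eventually.of_forall fun w => ?_)
  simp [Complex.log_im]

theorem contDiffOn_turn : ContDiffOn ℝ ∞ turn Complex.slitPlane := fun _ hz =>
  (((contDiffAt_arg hz).div_const _).add contDiffAt_const).contDiffWithinAt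

theorem contDiffAt_turnNeg {z : ℂ} (hz : -z ∈ Complex.slitPlane) : ContDiffAt ℝ ∞ turnNeg z :=
  (ContDiffAt.comp z (g := Complex.arg) (contDiffAt_arg hz) contDiffAt_id.neg).div_const _

theorem hasFDerivAt_area (z : ℂ) :
    HasFDerivAt area (Real.pi • (2 : ℝ) • innerSL ℝ z) z := by
  have := (hasStrictFDerivAt_norm_sq z).hasFDerivAt.const_smul Real.pi
  refine (this.congr_fderiv ?_).congr_of_eventuallyEq (Filter.Eventually.of_forall fun w => ?_)
  · ext v; simp; ring
  · simp [area]

/-- The Hamiltonian vector field of `F(u, v)` in area-angle coordinates: `2π ∂ᵤF` is the angular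
velocity, and `-∂ᵥF` is the rate of change of the area. -/
theorem planeHamVec_polar {h θ : ℂ → ℝ} {z : ℂ} {F : ℝ × ℝ → ℝ} {p q : ℝ} (hz : z ≠ 0)
    (hθ : HasFDerivAt θ (angleForm z) z)
    (hF : HasFDerivAt F (p • ContinuousLinearMap.fst ℝ ℝ ℝ + q • ContinuousLinearMap.snd ℝ ℝ ℝ)
      (area z, θ z))
    (hh : h =ᶠ[nhds z] fun w => F (area w, θ w)) :
    planeHamVec h z = (-(q / (2 * area z)) : ℝ) * z + (2 * Real.pi * p : ℝ) * Complex.I * z := by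
  have hd : HasFDerivAt h _ z :=
    (HasFDerivAt.comp z hF ((hasFDerivAt_area z).prodMk hθ)).congr_of_eventuallyEq hh
  have hn : Complex.normSq z ≠ 0 := (Complex.normSq_pos.2 hz).ne'
  have hn' : z.re * z.re + z.im * z.im ≠ 0 := by rwa [Complex.normSq_apply] at hn
  have hpi := Real.pi_pos
  obtain ⟨a, ha⟩ : ∃ a, a = -(q / (2 * area z)) := ⟨_, rfl⟩
  rw [planeHamVec, hd.fderiv, ← ha]
  rw [area, Complex.sq_norm, Complex.normSq_apply] at ha
  apply Complex.ext
  · simp [angleForm, Complex.normSq_apply, Complex.inner]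
    rw [ha]
    field_simp
  · simp [angleForm, Complex.normSq_apply, Complex.inner]
    rw [ha]
    field_simp
    ring

theorem planeHamVec_radial {h : ℂ → ℝ} {z : ℂ} {k : ℝ → ℝ} {p : ℝ} (hk : HasDerivAt k p (area z))
    (hh : h =ᶠ[nhds z] fun w => k (area w)) :
    planeHamVec h z = (2 * Real.pi * p : ℝ) * Complex.I * z := by
  have hd : HasFDerivAt h _ z :=
    (hk.comp_hasFDerivAt z (hasFDerivAt_area z)).congr_of_eventuallyEq hh
  rw [planeHamVec, hd.fderiv]
  apply Complex.ext
  · simp [Complex.inner]; ring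
  · simp [Complex.inner]; ring

theorem planeHamVec_angular {h θ : ℂ → ℝ} {z : ℂ} {k : ℝ → ℝ} {q : ℝ} (hz : z ≠ 0)
    (hθ : HasFDerivAt θ (angleForm z) z) (hk : HasDerivAt k q (θ z))
    (hh : h =ᶠ[nhds z] fun w => k (θ w)) :
    planeHamVec h z = (-(q / (2 * area z)) : ℝ) * z := by
  have := planeHamVec_polar (F := fun x => k x.2) (p := 0) (q := q) hz hθ ?_ hh
  · simpa using this
  · have := hk.hasFDerivAt.comp (area z, θ z) (hasFDerivAt_snd (𝕜 := ℝ) (E := ℝ) (F := ℝ))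
    refine this.congr_fderiv ?_
    ext <;> simp

theorem hasDerivWithinAt_pol {U V : ℝ → ℝ} {U' V' : ℝ} {s : Set ℝ} {t : ℝ}
    (hU : HasDerivWithinAt U U' s t) (hV : HasDerivWithinAt V V' s t) (hpos : 0 < U t) :
    HasDerivWithinAt (fun t => pol (U t) (V t))
      ((U' / (2 * U t) : ℝ) * pol (U t) (V t) +
        (2 * Real.pi * V' : ℝ) * Complex.I * pol (U t) (V t)) s t := by
  have hpi := Real.pi_pos
  have h1 := ((hU.div_const Real.pi).sqrt (by positivity)).ofReal_comp.neg
  have h2 := (((hV.const_mul (2 * Real.pi)).ofReal_comp).mul_const Complex.I).cexp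
  refine (h1.mul h2).congr_deriv ?_
  have hs : (Real.sqrt (U t / Real.pi) : ℝ) * Real.sqrt (U t / Real.pi) = U t / Real.pi :=
    Real.mul_self_sqrt (by positivity)
  have hs0 : Real.sqrt (U t / Real.pi) ≠ 0 := (Real.sqrt_pos.2 (by positivity)).ne'
  have e : U' / Real.pi / (2 * Real.sqrt (U t / Real.pi)) =
      U' / (2 * U t) * Real.sqrt (U t / Real.pi) := by
    rw [div_mul_eq_mul_div, div_eq_div_iff (by positivity) (by positivity)]
    calc U' / Real.pi * (2 * U t) = U' * 2 * (U t / Real.pi) := by ring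
      _ = U' * 2 * (Real.sqrt (U t / Real.pi) * Real.sqrt (U t / Real.pi)) := by rw [hs]
      _ = U' * Real.sqrt (U t / Real.pi) * (2 * Real.sqrt (U t / Real.pi)) := by ring
  simp only [e, pol, Pi.neg_apply]
  push_cast
  ring

/-! ### Opening a circle to a curve in the slit plane -/

/-- A smooth even function, `1` for `|v| ≤ τ` and `0` for `|v| ≥ 2τ`. -/
noncomputable def dip (τ v : ℝ) : ℝ := 1 - smoothStep (τ ^ 2) (4 * τ ^ 2) (v ^ 2)

/-- A smooth plateau, `1` on `[3τ, 1/2 - 2τ]` with support in `[2τ, 1/2 - τ]`. -/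
noncomputable def hump (τ v : ℝ) : ℝ :=
  smoothStep (2 * τ) (3 * τ) v * (1 - smoothStep (1 / 2 - 2 * τ) (1 / 2 - τ) v)

/-- The radial profile, for angles `v ∈ (0, 1)`, of the opened circle: it equals `c`, up to a
correction `κ` on the half turn `v < 1/2` and `-α` on the half turn `v > 1/2`, and it falls to
the small value `m` near the slit. -/
noncomputable def keyholeProfile (c α κ m τ v : ℝ) : ℝ :=
  (1 - (dip τ v + dip τ (v - 1))) *
    (c + κ * hump τ v - α * smoothStep (1 / 2 + τ) (1 / 2 + 2 * τ) v) +
    (dip τ v + dip τ (v - 1)) * m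

/-- The difference `c - keyholeProfile` for `κ = 0`, in the angle `v ∈ (-1/2, 1/2]` that is cut
along the positive real axis and is therefore smooth across the slit. -/
noncomputable def keyholeDefect (c α m τ v : ℝ) : ℝ :=
  dip τ v * (c - m) + (1 - dip τ v) *
    (α * (smoothStep (-1 / 2 + τ) (-1 / 2 + 2 * τ) v * (1 - smoothStep (-τ) 0 v)))

section

variable {c α κ m τ v : ℝ}

theorem contDiff_dip : ContDiff ℝ ∞ (dip τ) :=
  contDiff_const.sub (contDiff_smoothStep.comp (contDiff_id.pow 2))

theorem contDiff_hump : ContDiff ℝ ∞ (hump τ) :=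
  contDiff_smoothStep.mul (contDiff_const.sub contDiff_smoothStep)

theorem dip_nonneg : 0 ≤ dip τ v := sub_nonneg.2 smoothStep_le_one

theorem dip_le_one : dip τ v ≤ 1 := sub_le_self _ smoothStep_nonneg

theorem dip_eq_one (hτ : 0 < τ) (hv : |v| ≤ τ) : dip τ v = 1 := by
  rw [dip, smoothStep_of_le (by nlinarith) (sq_le_sq.2 (by rwa [abs_of_pos hτ])), sub_zero]

theorem dip_eq_zero (hτ : 0 < τ) (hv : 2 * τ ≤ |v|) : dip τ v = 0 := by
  rw [dip, smoothStep_of_ge (by nlinarith), sub_self]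
  rw [← sq_abs v]; nlinarith

theorem dip_neg : dip τ (-v) = dip τ v := by simp [dip]

theorem dip_antitoneOn : AntitoneOn (dip τ) (Ici 0) := by
  intro x hx y _ hxy
  have hx : 0 ≤ x := hx
  refine sub_le_sub_left (Real.smoothTransition.monotone ?_) 1
  refine div_le_div_of_nonneg_right ?_ (by nlinarith)
  nlinarith

theorem hump_nonneg : 0 ≤ hump τ v :=
  mul_nonneg smoothStep_nonneg (sub_nonneg.2 smoothStep_le_one)

theorem hump_le_one : hump τ v ≤ 1 :=
  mul_le_one₀ smoothStep_le_one (sub_nonneg.2 smoothStep_le_one) (sub_le_self _ smoothStep_nonneg)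

theorem hump_of_le (hτ : 0 < τ) (hv : v ≤ 2 * τ) : hump τ v = 0 := by
  rw [hump, smoothStep_of_le (by linarith) hv, zero_mul]

theorem hump_of_ge (hτ : 0 < τ) (hv : 1 / 2 - τ ≤ v) : hump τ v = 0 := by
  rw [hump, smoothStep_of_ge (lo := 1 / 2 - 2 * τ) (by linarith) hv, sub_self, mul_zero]

theorem hump_eq_one (hτ : 0 < τ) (h1 : 3 * τ ≤ v) (h2 : v ≤ 1 / 2 - 2 * τ) : hump τ v = 1 := by
  rw [hump, smoothStep_of_ge (by linarith) h1, smoothStep_of_le (by linarith) h2]; norm_num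

theorem contDiff_keyholeProfile : ContDiff ℝ ∞ (keyholeProfile c α κ m τ) := by
  have h1 : ContDiff ℝ ∞ (fun v => dip τ v + dip τ (v - 1)) :=
    contDiff_dip.add (contDiff_dip.comp (contDiff_id.sub contDiff_const))
  exact ((contDiff_const.sub h1).mul ((contDiff_const.add (contDiff_const.mul contDiff_hump)).sub
    (contDiff_const.mul contDiff_smoothStep))).add (h1.mul contDiff_const)

theorem contDiff_keyholeDefect : ContDiff ℝ ∞ (keyholeDefect c α m τ) :=
  (contDiff_dip.mul contDiff_const).add ((contDiff_const.sub contDiff_dip).mul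
    (contDiff_const.mul (contDiff_smoothStep.mul (contDiff_const.sub contDiff_smoothStep))))

theorem keyholeProfile_left (hτ : 0 < τ) (hτ' : τ ≤ 1 / 20) (hv : v ≤ 2 * τ) :
    keyholeProfile c α κ m τ v = c - dip τ v * (c - m) := by
  rw [keyholeProfile, hump_of_le hτ hv, smoothStep_of_le (by linarith) (by linarith),
    dip_eq_zero (v := v - 1) hτ (by rw [abs_of_nonpos (by linarith)]; linarith)]
  ring

theorem keyholeProfile_right (hτ : 0 < τ) (hτ' : τ ≤ 1 / 20) (hv : 1 - 2 * τ ≤ v) :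
    keyholeProfile c α κ m τ v = (c - α) - dip τ (v - 1) * (c - α - m) := by
  rw [keyholeProfile, hump_of_ge hτ (by linarith), smoothStep_of_ge (by linarith) (by linarith),
    dip_eq_zero (v := v) hτ (by rw [abs_of_nonneg (by linarith)]; linarith)]
  ring

theorem keyholeProfile_middle (hτ : 0 < τ) (hv : 2 * τ ≤ v) (hv' : v ≤ 1 - 2 * τ) :
    keyholeProfile c α κ m τ v =
      c + κ * hump τ v - α * smoothStep (1 / 2 + τ) (1 / 2 + 2 * τ) v := by
  rw [keyholeProfile, dip_eq_zero (v := v) hτ (by rw [abs_of_nonneg (by linarith)]; linarith),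
    dip_eq_zero (v := v - 1) hτ (by rw [abs_of_nonpos (by linarith)]; linarith)]
  ring

theorem keyholeDefect_nonneg (hm : m ≤ c) (hα : 0 ≤ α) : 0 ≤ keyholeDefect c α m τ v := by
  have := dip_nonneg (τ := τ) (v := v)
  have := dip_le_one (τ := τ) (v := v)
  have h1 : 0 ≤ smoothStep (-1 / 2 + τ) (-1 / 2 + 2 * τ) v * (1 - smoothStep (-τ) 0 v) :=
    mul_nonneg smoothStep_nonneg (sub_nonneg.2 smoothStep_le_one)
  exact add_nonneg (mul_nonneg dip_nonneg (by linarith))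
    (mul_nonneg (by linarith) (mul_nonneg hα h1))

theorem keyholeDefect_of_le (hτ : 0 < τ) (hτ' : τ ≤ 1 / 20) (hv : v ≤ -1 / 2 + τ) :
    keyholeDefect c α m τ v = 0 := by
  rw [keyholeDefect, dip_eq_zero hτ (by rw [abs_of_nonpos (by linarith)]; linarith),
    smoothStep_of_le (by linarith) hv]
  ring

theorem keyholeDefect_of_ge (hτ : 0 < τ) (hv : 2 * τ ≤ v) :
    keyholeDefect c α m τ v = 0 := by
  rw [keyholeDefect, dip_eq_zero hτ (by rw [abs_of_nonneg (by linarith)]; linarith),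
    smoothStep_of_ge (lo := -τ) (hi := 0) (by linarith) (by linarith)]
  ring

theorem keyholeProfile_eq (hτ : 0 < τ) (hτ' : τ ≤ 1 / 20) (hv : 0 ≤ v) (hv' : v ≤ 1 / 2) :
    keyholeProfile c α κ m τ v = c - keyholeDefect c α m τ v + κ * hump τ v := by
  rcases le_total v (2 * τ) with h | h
  · rw [keyholeProfile_left hτ hτ' h, keyholeDefect, hump_of_le hτ h,
      smoothStep_of_ge (lo := -τ) (hi := 0) (by linarith) hv]
    ring
  · rw [keyholeProfile_middle hτ h (by linarith), keyholeDefect_of_ge hτ h,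
      smoothStep_of_le (by linarith) (by linarith)]
    ring

theorem keyholeProfile_add_one (hτ : 0 < τ) (hτ' : τ ≤ 1 / 20) (hv : -1 / 2 ≤ v) (hv' : v ≤ 0) :
    keyholeProfile c α κ m τ (v + 1) = c - keyholeDefect c α m τ v + κ * hump τ v := by
  have e : smoothStep (-1 / 2 + τ) (-1 / 2 + 2 * τ) v =
      smoothStep (1 / 2 + τ) (1 / 2 + 2 * τ) (v + 1) := by
    unfold smoothStep; congr 1; ring
  rw [hump_of_le hτ (by linarith)]
  rcases le_total v (-2 * τ) with h | h
  · rw [keyholeProfile_middle hτ (by linarith) (by linarith), hump_of_ge hτ (by linarith),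
      keyholeDefect, dip_eq_zero hτ (by rw [abs_of_nonpos (by linarith)]; linarith), e,
      smoothStep_of_le (lo := -τ) (hi := 0) (by linarith) (by linarith)]
    ring
  · rw [keyholeProfile_right hτ hτ' (by linarith), add_sub_cancel_right, keyholeDefect,
      smoothStep_of_ge (lo := -1 / 2 + τ) (by linarith) (by linarith)]
    rcases le_total v (-τ) with h' | h'
    · rw [smoothStep_of_le (lo := -τ) (hi := 0) (by linarith) h']; ring
    · rw [dip_eq_one hτ (by rw [abs_of_nonpos hv']; linarith)]; ring

theorem keyholeDefect_le (hmα : m ≤ c - α) (hα : 0 ≤ α) :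
    keyholeDefect c α m τ v ≤ c - m := by
  have h1 : smoothStep (-1 / 2 + τ) (-1 / 2 + 2 * τ) v * (1 - smoothStep (-τ) 0 v) ≤ 1 :=
    mul_le_one₀ smoothStep_le_one (sub_nonneg.2 smoothStep_le_one) (sub_le_self _ smoothStep_nonneg)
  have := dip_le_one (τ := τ) (v := v)
  rw [keyholeDefect]
  nlinarith [mul_le_mul_of_nonneg_left h1 hα]

theorem keyholeDefect_le_of_le (hτ : 0 < τ) (hα : 0 ≤ α) (hv : v ≤ -2 * τ) :
    keyholeDefect c α m τ v ≤ α := by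
  have h1 : smoothStep (-1 / 2 + τ) (-1 / 2 + 2 * τ) v * (1 - smoothStep (-τ) 0 v) ≤ 1 :=
    mul_le_one₀ smoothStep_le_one (sub_nonneg.2 smoothStep_le_one) (sub_le_self _ smoothStep_nonneg)
  rw [keyholeDefect, dip_eq_zero hτ (by rw [abs_of_nonpos (by linarith)]; linarith)]
  nlinarith

theorem integral_le_const_mul {f : ℝ → ℝ} (hf : Continuous f) {x y C : ℝ} (hxy : x ≤ y)
    (h : ∀ t ∈ Icc x y, f t ≤ C) : ∫ t in x..y, f t ≤ C * (y - x) := by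
  have := intervalIntegral.integral_mono_on hxy (hf.intervalIntegrable x y)
    (continuous_const.intervalIntegrable (μ := MeasureTheory.volume) x y) h
  rw [intervalIntegral.integral_const, smul_eq_mul] at this
  linarith

theorem const_mul_le_integral {f : ℝ → ℝ} (hf : Continuous f) {x y C : ℝ} (hxy : x ≤ y)
    (h : ∀ t ∈ Icc x y, C ≤ f t) : C * (y - x) ≤ ∫ t in x..y, f t := by
  have := intervalIntegral.integral_mono_on hxy
    (continuous_const.intervalIntegrable (μ := MeasureTheory.volume) x y)
    (hf.intervalIntegrable x y) h
  rw [intervalIntegral.integral_const, smul_eq_mul] at this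
  linarith

/-- The constant `κ` for which the opened curve bounds the same area as the circle. -/
theorem exists_keyhole_constant {η : ℝ} (hτ : 0 < τ) (hτ' : τ ≤ 1 / 20) (hη : 0 < η)
    (hα : 0 ≤ α) (hm : 0 ≤ m) (hmα : m ≤ c - α) (hs : 20 * τ * (c + α + η) ≤ η) :
    ∃ κ, 0 ≤ κ ∧ κ ≤ α + η ∧
      ∫ v in (-1 / 2 : ℝ)..(1 / 2), (κ * hump τ v - keyholeDefect c α m τ v) = 0 := by
  have cd : Continuous (keyholeDefect c α m τ) := contDiff_keyholeDefect.continuous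
  have ch : Continuous (hump τ) := contDiff_hump.continuous
  have id : ∀ x y, IntervalIntegrable (keyholeDefect c α m τ) MeasureTheory.volume x y :=
    fun x y => cd.intervalIntegrable x y
  have ih : ∀ x y, IntervalIntegrable (hump τ) MeasureTheory.volume x y :=
    fun x y => ch.intervalIntegrable x y
  set D := ∫ v in (-1 / 2 : ℝ)..(1 / 2), keyholeDefect c α m τ v with hD
  set E := ∫ v in (-1 / 2 : ℝ)..(1 / 2), hump τ v with hE
  have hD0 : 0 ≤ D := by
    simpa using const_mul_le_integral cd (by norm_num)
      fun t _ => keyholeDefect_nonneg (by linarith) hα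
  have hD1 : D ≤ α / 2 + 4 * τ * c := by
    rw [hD, ← intervalIntegral.integral_add_adjacent_intervals (id (-1 / 2) (-2 * τ))
      (id (-2 * τ) (1 / 2)), ← intervalIntegral.integral_add_adjacent_intervals
      (id (-2 * τ) (2 * τ)) (id (2 * τ) (1 / 2))]
    have h1 := integral_le_const_mul cd (x := -1 / 2) (y := -2 * τ) (C := α) (by linarith)
      fun t ht => keyholeDefect_le_of_le hτ hα ht.2
    have h2 := integral_le_const_mul cd (x := -2 * τ) (y := 2 * τ) (C := c) (by linarith)
      fun t _ => (keyholeDefect_le hmα hα).trans (by linarith)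
    have h3 := integral_le_const_mul cd (x := 2 * τ) (y := 1 / 2) (C := 0) (by linarith)
      fun t ht => (keyholeDefect_of_ge hτ ht.1).le
    nlinarith
  have hE1 : 1 / 2 - 5 * τ ≤ E := by
    rw [hE, ← intervalIntegral.integral_add_adjacent_intervals (ih (-1 / 2) (3 * τ))
      (ih (3 * τ) (1 / 2)), ← intervalIntegral.integral_add_adjacent_intervals
      (ih (3 * τ) (1 / 2 - 2 * τ)) (ih (1 / 2 - 2 * τ) (1 / 2))]
    have h1 := const_mul_le_integral ch (x := -1 / 2) (y := 3 * τ) (C := 0) (by linarith)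
      fun t _ => hump_nonneg
    have h2 := const_mul_le_integral ch (x := 3 * τ) (y := 1 / 2 - 2 * τ) (C := 1) (by linarith)
      fun t ht => (hump_eq_one hτ ht.1 ht.2).ge
    have h3 := const_mul_le_integral ch (x := 1 / 2 - 2 * τ) (y := 1 / 2) (C := 0) (by linarith)
      fun t _ => hump_nonneg
    linarith
  have hE0 : 0 < E := by linarith
  refine ⟨D / E, div_nonneg hD0 hE0.le, ?_, ?_⟩
  · rw [div_le_iff₀ hE0]
    nlinarith
  · rw [intervalIntegral.integral_sub ((ih _ _).const_mul _) (id _ _),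
      intervalIntegral.integral_const_mul, ← hD, ← hE, div_mul_cancel₀ _ hE0.ne', sub_self]

end

theorem neg_mem_slitPlane_iff_turnNeg {w : ℂ} :
    -w ∈ Complex.slitPlane ↔ turnNeg w < 1 / 2 ∧ w ≠ 0 := by
  rw [mem_slitPlane_iff_turn, neg_ne_zero, turn, turnNeg]
  refine and_congr ⟨fun h => ?_, fun h => ?_⟩ Iff.rfl <;> linarith

theorem pol_sub_one (u v : ℝ) : pol u (v - 1) = pol u v := by
  rw [← pol_add_one, sub_add_cancel]

theorem turnNeg_eq {w : ℂ} (hw : w ∈ Complex.slitPlane) :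
    (turn w ≤ 1 / 2 ∧ turnNeg w = turn w) ∨ (1 / 2 < turn w ∧ turnNeg w = turn w - 1) := by
  have h := turn_mem hw
  have ha := area_pos_of_mem hw
  rcases le_or_gt (turn w) (1 / 2) with h2 | h2
  · refine Or.inl ⟨h2, ?_⟩
    have := turnNeg_pol ha (v := turn w) (by linarith [h.1]) h2
    rwa [pol_area_turn] at this
  · refine Or.inr ⟨h2, ?_⟩
    have := turnNeg_pol ha (v := turn w - 1) (by linarith [h.1]) (by linarith [h.2])
    rwa [pol_sub_one, pol_area_turn] at this

theorem norm_le_of_area_le {w : ℂ} {M : ℝ} (h : area w ≤ M) : ‖w‖ ≤ Real.sqrt (M / Real.pi) := by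
  rw [norm_eq_sqrt_area]
  exact Real.sqrt_le_sqrt (div_le_div_of_nonneg_right h Real.pi_pos.le)

theorem isCompact_area (x y : ℝ) : IsCompact {w | x ≤ area w ∧ area w ≤ y} := by
  refine Metric.isCompact_of_isClosed_isBounded ?_ ?_
  · exact (isClosed_le continuous_const continuous_area).inter
      (isClosed_le continuous_area continuous_const)
  · exact Metric.isBounded_iff_subset_closedBall 0 |>.2 ⟨_, fun w hw =>
      mem_closedBall_zero_iff.2 (norm_le_of_area_le hw.2)⟩

/-- A function of the angle that vanishes near the half line where the angle `turnNeg` jumps is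
smooth outside the origin. -/
theorem contDiffOn_comp_turnNeg {k : ℝ → ℝ} (hk : ContDiff ℝ ∞ k) {τ : ℝ} (hτ : 0 < τ)
    (h0 : ∀ v, v ≤ -1 / 2 + τ → k v = 0) (h1 : ∀ v, 1 / 2 - τ ≤ v → k v = 0) :
    ContDiffOn ℝ ∞ (fun w => k (turnNeg w)) {0}ᶜ ∧
      ∀ w, w ≠ 0 → turnNeg w = 1 / 2 → (fun w => k (turnNeg w)) =ᶠ[nhds w] fun _ => 0 := by
  have key : ∀ w, w ≠ 0 → turnNeg w = 1 / 2 →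
      (fun w => k (turnNeg w)) =ᶠ[nhds w] fun _ => 0 := by
    intro w hw ht
    have hw' : w = pol (area w) (1 / 2) := by rw [← ht, pol_area_turnNeg]
    have hs : w ∈ Complex.slitPlane := by
      rw [hw']; exact pol_mem_slitPlane (area_pos.2 hw) (by norm_num) (by norm_num)
    have htw : turn w = 1 / 2 := by
      rw [hw']; exact turn_pol (area_pos.2 hw) (by norm_num) (by norm_num)
    have hc := (hasFDerivAt_turn hs).continuousAt.tendsto
    rw [htw] at hc
    filter_upwards [Complex.isOpen_slitPlane.mem_nhds hs,
      hc (Ioo_mem_nhds (show 1 / 2 - τ < 1 / 2 by linarith) (show 1 / 2 < 1 / 2 + τ by linarith))]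
      with x hx hx'
    rcases turnNeg_eq hx with ⟨h, e⟩ | ⟨h, e⟩
    · rw [e]; exact h1 _ hx'.1.le
    · rw [e]; exact h0 _ (by linarith [hx'.2])
  refine ⟨fun w hw => ContDiffAt.contDiffWithinAt ?_, key⟩
  rcases (turnNeg_mem w).2.lt_or_eq with h | h
  · exact hk.contDiffAt.comp w (contDiffAt_turnNeg (neg_mem_slitPlane_iff_turnNeg.2 ⟨h, hw⟩))
  · exact contDiffAt_const.congr_of_eventuallyEq (key w hw h)

/-- A shear along the rays through the origin takes the circle of area `c` to the curve
`u = c + k' (v)`, for every `k` that vanishes near `±1/2`. -/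
theorem exists_star_shear {k ρ : ℝ → ℝ} (hk : ContDiff ℝ ∞ k) (hρ : ∀ v, HasDerivAt k (-ρ v) v)
    {τ c M m : ℝ} (hτ : 0 < τ)
    (h0 : ∀ v, v ≤ -1 / 2 + τ → k v = 0) (h1 : ∀ v, 1 / 2 - τ ≤ v → k v = 0)
    (hm : 0 < m) (hmc : m ≤ c) (hcM : c ≤ M) (hρm : ∀ v, m ≤ c + ρ v) (hρM : ∀ v, c + ρ v ≤ M) :
    ∃ h, IsTestFun h ∧ ∀ w, area w = c → ∀ t ∈ Icc (0 : ℝ) 1,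
      planeFlow h t w = pol (c + t * ρ (turnNeg w)) (turnNeg w) := by
  obtain ⟨hsm, hnear⟩ := contDiffOn_comp_turnNeg hk hτ h0 h1
  have hne : ∀ w, m ≤ area w → w ≠ 0 := fun w hw => area_pos.1 (hm.trans_le hw)
  obtain ⟨h, hh, hhk⟩ := exists_isTestFun_eq_near hsm (isCompact_area m M) isOpen_compl_singleton
    fun w hw => hne w hw.1
  refine ⟨h, hh, fun w hw t ht => ?_⟩
  set v := turnNeg w with hv
  have hv12 := turnNeg_mem w
  have hU : ∀ t ∈ Icc (0 : ℝ) 1, m ≤ c + t * ρ v ∧ c + t * ρ v ≤ M := fun t ht => by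
    have := hρm v
    have := hρM v
    constructor <;> nlinarith [ht.1, ht.2]
  have hγ : ∀ t ∈ Icc (0 : ℝ) 1, HasDerivWithinAt (fun t => pol (c + t * ρ v) v)
      ((1 : ℝ) • planeHamVec h (pol (c + t * ρ v) v)) (Icc 0 1) t := by
    intro t ht
    have hpos : 0 < c + t * ρ v := hm.trans_le (hU t ht).1
    have hn := hhk _ (show pol (c + t * ρ v) v ∈ {w | m ≤ area w ∧ area w ≤ M} by
      rw [mem_ofPred_eq, area_pol hpos.le]; exact hU t ht)
    have htn : turnNeg (pol (c + t * ρ v) v) = v :=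
      turnNeg_pol hpos (by linarith [hv12.1]) hv12.2
    have hd := hasDerivWithinAt_pol (s := Icc 0 1) (t := t) (U := fun t => c + t * ρ v)
      (V := fun _ => v) (U' := ρ v) (V' := 0)
      (by simpa using (((hasDerivAt_id t).mul_const (ρ v)).const_add c).hasDerivWithinAt)
      (hasDerivWithinAt_const _ _ _) hpos
    refine hd.congr_deriv ?_
    rcases hv12.2.lt_or_eq with hlt | heq
    · rw [planeHamVec_angular (pol_ne_zero hpos v) (hasFDerivAt_turnNeg
        (neg_mem_slitPlane_iff_turnNeg.2 ⟨by rwa [htn], pol_ne_zero hpos v⟩)) (hρ _) hn, htn,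
        area_pol hpos.le]
      simp; ring
    · have hn0 := hn.trans (hnear _ (pol_ne_zero hpos v) (by rw [htn, hv, heq]))
      have hρ0 : ρ v = 0 := by
        have hev : k =ᶠ[nhds v] fun _ => 0 := by
          filter_upwards [Ioi_mem_nhds (show 1 / 2 - τ < v by rw [hv, heq]; linarith)] with x hx
          exact h1 x (le_of_lt hx)
        have := (hρ v).unique ((hasDerivAt_const v (0 : ℝ)).congr_of_eventuallyEq hev)
        linarith
      rw [planeHamVec_congr hn0, planeHamVec_const, hρ0]
      simp
  have := hh.eq_planeFlow_of_Icc 1 hγ ht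
  have e0 : pol (c + 0 * ρ v) v = w := by rw [zero_mul, add_zero, ← hw, pol_area_turnNeg]
  simp only [e0, mul_one] at this
  exact this.symm

/-- A Hamiltonian supported in the disc of area `8m` that is odd under conjugation and translates
the point `-√(m/π)` to `√(m/π)`. -/
theorem exists_push {m : ℝ} (hm : 0 < m) :
    ∃ h, IsTestFun h ∧ tsupport h ⊆ {w | area w ≤ 8 * m} ∧ (∀ z, h (starRingEnd ℂ z) = -h z) ∧
      planeFlow h 1 (pol m 0) = pol m (1 / 2) := by
  set x := Real.sqrt (m / Real.pi) with hx
  have hpi := Real.pi_pos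
  have hx2 : Real.pi * x ^ 2 = m := by
    rw [hx, Real.sq_sqrt (by positivity)]; field_simp
  set h : ℂ → ℝ := fun w => (1 - smoothStep (4 * m) (8 * m) (area w)) * (-(2 * x) * w.im) with hh
  have hsupp : tsupport h ⊆ {w | area w ≤ 8 * m} := by
    refine closure_minimal (fun w hw => ?_) (isClosed_le continuous_area continuous_const)
    by_contra H
    rw [mem_ofPred_eq, not_le] at H
    apply hw
    simp only [hh]
    rw [smoothStep_of_ge (by linarith) H.le, sub_self, zero_mul]
  have ht : IsTestFun h := by
    refine ⟨?_, ?_⟩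
    · exact (contDiff_const.sub (contDiff_smoothStep.comp contDiff_area)).mul
        (contDiff_const.mul Complex.imCLM.contDiff)
    · refine (isCompact_area 0 (8 * m)).of_isClosed_subset (isClosed_tsupport _) fun w hw => ?_
      exact ⟨area_nonneg w, hsupp hw⟩
  refine ⟨h, ht, hsupp, fun z => ?_, ?_⟩
  · simp [hh, area]
  · have e0 : pol m 0 = ((-x : ℝ) : ℂ) := by simp [pol, ← hx]
    have e1 : pol m (1 / 2) = ((x : ℝ) : ℂ) := by rw [pol_eq, ← hx]; simp
    have hγ : ∀ t ∈ Icc (0 : ℝ) 1, HasDerivWithinAt (fun t : ℝ => ((-x + t * (2 * x) : ℝ) : ℂ))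
        ((1 : ℝ) • planeHamVec h ((-x + t * (2 * x) : ℝ) : ℂ)) (Icc 0 1) t := by
      intro t ht'
      have hd : HasDerivAt (fun t : ℝ => -x + t * (2 * x)) (2 * x) t := by
        simpa using ((hasDerivAt_id t).mul_const (2 * x)).const_add (-x)
      refine hd.ofReal_comp.hasDerivWithinAt.congr_deriv ?_
      have ha : area ((-x + t * (2 * x) : ℝ) : ℂ) < 4 * m := by
        rw [area, Complex.norm_real, Real.norm_eq_abs, sq_abs, ← hx2]
        have hx0 : 0 < x := Real.sqrt_pos.2 (by positivity)
        have : (-x + t * (2 * x)) ^ 2 ≤ x ^ 2 := by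
          have : 0 ≤ t * (1 - t) := mul_nonneg ht'.1 (by linarith [ht'.2])
          nlinarith
        nlinarith
      have hn : h =ᶠ[nhds ((-x + t * (2 * x) : ℝ) : ℂ)] fun w => -(2 * x) * w.im := by
        filter_upwards [continuous_area.continuousAt.eventually_lt continuousAt_const ha] with w hw
        simp only [hh]
        rw [smoothStep_of_le (by linarith) hw.le]; ring
      have hf : HasFDerivAt (fun w : ℂ => -(2 * x) * w.im) (-(2 * x) • Complex.imCLM)
          ((-x + t * (2 * x) : ℝ) : ℂ) :=
        (Complex.imCLM.hasFDerivAt).const_mul (-(2 * x))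
      rw [planeHamVec_congr hn, planeHamVec, hf.fderiv]
      apply Complex.ext <;> simp
    have := ht.eq_planeFlow_of_Icc 1 hγ (t := 1) ⟨zero_le_one, le_rfl⟩
    simp only [zero_mul, add_zero, mul_one, one_mul] at this
    rw [e0, e1, ← this]
    congr 1; ring

theorem im_pol (u v : ℝ) :
    (pol u v).im = -(Real.sqrt (u / Real.pi) * Real.sin (2 * Real.pi * v)) := by
  rw [pol, neg_mul, Complex.neg_im, Complex.im_ofReal_mul, Complex.exp_ofReal_mul_I_im]

/-- The circle of area `c` can be moved by two successive Hamiltonian flows of the plane to a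
curve in the slit plane, which outside a small disc is the graph of `keyholeProfile`. The first
flow is a shear along the rays; it leaves one point of the curve on the slit, at area `m`, and
the second flow pushes that point across the origin. -/
theorem exists_keyhole {c α η uc τ : ℝ} (hτ : 0 < τ) (hτ' : τ ≤ 1 / 20) (hη : 0 < η)
    (hα : 0 ≤ α) (huc : 0 < uc) (hucα : uc ≤ c - α) (hs : 20 * τ * (c + α + η) ≤ η) :
    ∃ κ, 0 ≤ κ ∧ κ ≤ α + η ∧ ∃ h₁ h₂, IsTestFun h₁ ∧ IsTestFun h₂ ∧ ∀ w, area w = c →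
      (∀ t ∈ Icc (0 : ℝ) 1, area (planeFlow h₁ t w) ≤ c + κ) ∧
      (∀ t ∈ Icc (0 : ℝ) 1, area (planeFlow h₂ t (planeFlow h₁ 1 w)) ≤ c + κ) ∧
      planeFlow h₂ 1 (planeFlow h₁ 1 w) ∈ Complex.slitPlane ∧
      (uc ≤ area (planeFlow h₂ 1 (planeFlow h₁ 1 w)) →
        area (planeFlow h₂ 1 (planeFlow h₁ 1 w)) =
          keyholeProfile c α κ (uc / 16) τ (turn (planeFlow h₂ 1 (planeFlow h₁ 1 w)))) := by
  set m := uc / 16 with hm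
  have hm0 : 0 < m := by positivity
  obtain ⟨κ, hκ0, hκ1, hint⟩ := exists_keyhole_constant (c := c) (m := m) hτ hτ' hη hα hm0.le
    (by linarith) hs
  refine ⟨κ, hκ0, hκ1, ?_⟩
  set ρ : ℝ → ℝ := fun v => κ * hump τ v - keyholeDefect c α m τ v with hρ
  have sρ : ContDiff ℝ ∞ ρ := (contDiff_const.mul contDiff_hump).sub contDiff_keyholeDefect
  set k : ℝ → ℝ := fun v => -∫ s in (-1 / 2 : ℝ)..v, ρ s with hk
  have dk : ∀ v, HasDerivAt k (-ρ v) v := fun v =>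
    (sρ.continuous.integral_hasStrictDerivAt (-1 / 2) v).hasDerivAt.neg
  have sk : ContDiff ℝ ∞ k := by
    refine contDiff_infty_iff_deriv.2 ⟨fun v => (dk v).differentiableAt, ?_⟩
    rw [show deriv k = fun v => -ρ v from funext fun v => (dk v).deriv]
    exact sρ.neg
  have ρ0 : ∀ v, v ≤ -1 / 2 + τ → ρ v = 0 := fun v hv => by
    simp only [hρ]
    rw [hump_of_le hτ (by linarith), keyholeDefect_of_le hτ hτ' hv]; ring
  have ρ1 : ∀ v, 1 / 2 - τ ≤ v → ρ v = 0 := fun v hv => by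
    simp only [hρ]
    rw [hump_of_ge hτ hv, keyholeDefect_of_ge hτ (by linarith)]; ring
  have k0 : ∀ v, v ≤ -1 / 2 + τ → k v = 0 := fun v hv => by
    simp only [hk, neg_eq_zero]
    refine intervalIntegral.integral_zero_ae (Filter.Eventually.of_forall fun s hs => ρ0 s ?_)
    rcases hs with ⟨-, hs⟩
    exact hs.trans (max_le (by linarith) hv)
  have k1 : ∀ v, 1 / 2 - τ ≤ v → k v = 0 := fun v hv => by
    have : ∫ s in (1 / 2 : ℝ)..v, ρ s = 0 := by
      refine intervalIntegral.integral_zero_ae (Filter.Eventually.of_forall fun s hs => ρ1 s ?_)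
      rcases hs with ⟨hs, -⟩
      exact (le_min (by linarith) hv).trans hs.le
    simp only [hk, neg_eq_zero]
    rw [← intervalIntegral.integral_add_adjacent_intervals
      (sρ.continuous.intervalIntegrable (-1 / 2) (1 / 2))
      (sρ.continuous.intervalIntegrable (1 / 2) v), this, hint, add_zero]
  have ρm : ∀ v, m ≤ c + ρ v := fun v => by
    have h1 := keyholeDefect_le (c := c) (α := α) (m := m) (τ := τ) (v := v) (by linarith) hα
    have h2 := mul_nonneg hκ0 (hump_nonneg (τ := τ) (v := v))
    simp only [hρ]; linarith
  have ρM : ∀ v, c + ρ v ≤ c + κ := fun v => by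
    have h1 := keyholeDefect_nonneg (c := c) (α := α) (m := m) (τ := τ) (v := v) (by linarith) hα
    have h2 := mul_le_mul_of_nonneg_left (hump_le_one (τ := τ) (v := v)) hκ0
    simp only [hρ]; linarith
  obtain ⟨h₁, ht₁, hflow₁⟩ := exists_star_shear sk dk (c := c) (M := c + κ) hτ k0 k1 hm0
    (by linarith) (by linarith) ρm ρM
  obtain ⟨h₂, ht₂, hsupp, hodd, hpush⟩ := exists_push hm0
  refine ⟨h₁, h₂, ht₁, ht₂, fun w hw => ?_⟩
  set v := turnNeg w with hv
  have hvm : v ∈ Ioc (-(1 / 2) : ℝ) (1 / 2) := turnNeg_mem w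
  have hp : planeFlow h₁ 1 w = pol (c + ρ v) v := by
    rw [hflow₁ w hw 1 ⟨zero_le_one, le_rfl⟩, one_mul]
  have hpos : 0 < c + ρ v := hm0.trans_le (ρm v)
  have harea : area (planeFlow h₁ 1 w) = c + ρ v := by rw [hp, area_pol hpos.le]
  set p := planeFlow h₁ 1 w
  have hstat : p ∉ tsupport h₂ → ∀ t, planeFlow h₂ t p = p := fun h t =>
    ht₂.planeFlow_eq_self (planeHamVec_eq_zero_of_notMem_tsupport h) t
  refine ⟨fun t ht => ?_, fun t _ => ?_, ?_, fun huq => ?_⟩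
  · have h1 := ρm v
    have h2 := ρM v
    rw [hflow₁ w hw t ht, area_pol] <;> nlinarith [ht.1, ht.2]
  · by_cases hps : p ∈ tsupport h₂
    · have : area (planeFlow h₂ t p) ≤ 8 * m := hsupp (ht₂.planeFlow_mem_tsupport hps t)
      linarith
    · rw [hstat hps, harea]; exact ρM v
  · by_cases him : p.im = 0
    · -- the only real points of the sheared curve have angles `0` and `1/2`
      have hsin : Real.sin (2 * Real.pi * v) = 0 := by
        rw [hp, im_pol] at him
        have : Real.sqrt ((c + ρ v) / Real.pi) ≠ 0 :=
          (Real.sqrt_pos.2 (div_pos hpos Real.pi_pos)).ne'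
        simpa [this] using him
      obtain ⟨n, hn⟩ := Real.sin_eq_zero_iff.1 hsin
      have hn2 : (n : ℝ) = 2 * v := by
        have := Real.pi_pos
        exact mul_right_cancel₀ this.ne' (by linarith)
      have hn3 : n = 0 ∨ n = 1 := by
        have h1 : (-1 : ℝ) < n := by linarith [hvm.1]
        have h2 : (n : ℝ) ≤ 1 := by linarith [hvm.2]
        have h1' : (-1 : ℤ) < n := by exact_mod_cast h1
        have h2' : n ≤ 1 := by exact_mod_cast h2
        omega
      rcases hn3 with rfl | rfl
      · have hv0 : v = 0 := by simpa using hn2.symm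
        have hρ0 : c + ρ v = m := by
          simp only [hρ, keyholeDefect]
          rw [hv0, dip_eq_one hτ (by simpa using hτ.le), hump_of_le hτ (by linarith)]; ring
        rw [hp, hρ0, hv0, hpush]
        exact pol_mem_slitPlane hm0 (by norm_num) (by norm_num)
      · have hv0 : v = 1 / 2 := by push_cast at hn2; linarith
        have hρ0 : ρ v = 0 := ρ1 v (by linarith)
        have : p ∉ tsupport h₂ := fun h => by
          have : area p ≤ 8 * m := hsupp h
          rw [harea, hρ0] at this
          linarith
        rw [hstat this, hp, hv0]
        exact pol_mem_slitPlane (by rwa [← hv0]) (by norm_num) (by norm_num)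
    · exact Complex.mem_slitPlane_iff.2 (Or.inr (ht₂.im_planeFlow_ne_zero hodd him 1))
  · have hps : p ∉ tsupport h₂ := fun h => by
      have : area (planeFlow h₂ 1 p) ≤ 8 * m := hsupp (ht₂.planeFlow_mem_tsupport h 1)
      linarith
    rw [hstat hps] at huq ⊢
    rw [harea] at huq ⊢
    have hv0 : v ≠ 0 := fun hv0 => by
      have hρ0 : c + ρ v = m := by
        simp only [hρ, keyholeDefect]
        rw [hv0, dip_eq_one hτ (by simpa using hτ.le), hump_of_le hτ (by linarith)]; ring
      linarith
    rcases lt_or_gt_of_ne hv0 with hneg | hpos'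
    · rw [hp, ← pol_add_one, turn_pol hpos (by linarith [hvm.1]) (by linarith),
        keyholeProfile_add_one hτ hτ' (by linarith [hvm.1]) hneg.le]
      ring
    · rw [hp, turn_pol hpos hpos' (by linarith [hvm.2]),
        keyholeProfile_eq hτ hτ' hpos'.le hvm.2]
      ring

/-! ### Trajectories in area-angle coordinates -/

/-- Hamiltonians depending on the angle alone move points along rays. -/
theorem hasDerivWithinAt_ray {h : ℂ → ℝ} {κ : ℝ → ℝ} {q c u v t : ℝ} {s : Set ℝ}
    (hpos : 0 < u - t * (c * q)) (h0 : 0 < v) (h1 : v < 1) (hκ : HasDerivAt κ q v)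
    (hn : h =ᶠ[nhds (pol (u - t * (c * q)) v)] fun w => κ (turn w)) :
    HasDerivWithinAt (fun t => pol (u - t * (c * q)) v)
      (c • planeHamVec h (pol (u - t * (c * q)) v)) s t := by
  have hd := hasDerivWithinAt_pol (s := s) (t := t) (U := fun t => u - t * (c * q))
    (V := fun _ => v) (U' := -(c * q)) (V' := 0)
    (by simpa using (((hasDerivAt_id t).mul_const (c * q)).const_sub u).hasDerivWithinAt)
    (hasDerivWithinAt_const _ _ _) hpos
  refine hd.congr_deriv ?_
  rw [planeHamVec_angular (pol_ne_zero hpos v) (hasFDerivAt_turn (pol_mem_slitPlane hpos h0 h1))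
    (by rwa [turn_pol hpos h0 h1.le]) hn, area_pol hpos.le]
  simp; ring

/-- Radial Hamiltonians rotate points. -/
theorem hasDerivWithinAt_rotation {h : ℂ → ℝ} {κ : ℝ → ℝ} {p c u v t : ℝ} {s : Set ℝ}
    (hpos : 0 < u) (hκ : HasDerivAt κ p u) (hn : ∀ w, h w = κ (area w)) :
    HasDerivWithinAt (fun t => pol u (v + t * (c * p)))
      (c • planeHamVec h (pol u (v + t * (c * p)))) s t := by
  have hd := hasDerivWithinAt_pol (s := s) (t := t) (U := fun _ => u)
    (V := fun t => v + t * (c * p)) (U' := 0) (V' := c * p) (hasDerivWithinAt_const _ _ _)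
    (by simpa using (((hasDerivAt_id t).mul_const (c * p)).const_add v).hasDerivWithinAt) hpos
  refine hd.congr_deriv ?_
  rw [planeHamVec_radial (k := κ) (by rwa [area_pol hpos.le])
    (Filter.Eventually.of_forall fun w => hn w)]
  simp; ring

/-- A sector of an annulus in the slit plane. -/
def sector (x₀ x₁ y₀ y₁ : ℝ) : Set ℂ :=
  {z | (x₀ ≤ area z ∧ area z ≤ x₁) ∧ y₀ ≤ turn z ∧ turn z ≤ y₁}

theorem continuous_pol : Continuous fun x : ℝ × ℝ => pol x.1 x.2 := by
  unfold pol; fun_prop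

theorem sector_subset_slitPlane {x₀ x₁ y₀ y₁ : ℝ} (hx : 0 < x₀) (hy : y₁ < 1) :
    sector x₀ x₁ y₀ y₁ ⊆ Complex.slitPlane := fun _ hz =>
  mem_slitPlane_iff_turn.2 ⟨hz.2.2.trans_lt hy, area_pos.1 (hx.trans_le hz.1.1)⟩

theorem pol_mem_sector {x₀ x₁ y₀ y₁ u v : ℝ} (hx : 0 < x₀) (hy₀ : 0 < y₀) (hy : y₁ < 1)
    (hu₀ : x₀ ≤ u) (hu₁ : u ≤ x₁) (hv₀ : y₀ ≤ v) (hv₁ : v ≤ y₁) :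
    pol u v ∈ sector x₀ x₁ y₀ y₁ := by
  have hu : 0 < u := hx.trans_le hu₀
  refine ⟨?_, ?_⟩
  · rw [area_pol hu.le]; exact ⟨hu₀, hu₁⟩
  · rw [turn_pol hu (by linarith) (by linarith)]; exact ⟨hv₀, hv₁⟩

theorem isCompact_sector {x₀ x₁ y₀ y₁ : ℝ} (hx : 0 < x₀) (hy₀ : 0 < y₀) (hy : y₁ < 1) :
    IsCompact (sector x₀ x₁ y₀ y₁) := by
  have : sector x₀ x₁ y₀ y₁ = (fun x : ℝ × ℝ => pol x.1 x.2) '' (Icc x₀ x₁ ×ˢ Icc y₀ y₁) := by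
    ext z
    constructor
    · intro hz
      exact ⟨(area z, turn z), ⟨⟨hz.1.1, hz.1.2⟩, ⟨hz.2.1, hz.2.2⟩⟩, pol_area_turn z⟩
    · rintro ⟨⟨u, v⟩, ⟨hu, hv⟩, rfl⟩
      exact pol_mem_sector hx hy₀ hy hu.1 hu.2 hv.1 hv.2
  rw [this]
  exact (isCompact_Icc.prod isCompact_Icc).image continuous_pol

theorem exists_subset_sector {C : Set ℂ} (hC : IsCompact C) (hs : C ⊆ Complex.slitPlane) {M : ℝ}
    (hM : ∀ z ∈ C, area z ≤ M) : ∃ δ, 0 < δ ∧ δ ≤ 1 / 4 ∧ C ⊆ sector δ M δ (1 - δ) := by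
  have ht : ContinuousOn turn C := contDiffOn_turn.continuousOn.mono hs
  obtain ⟨δ, hδ, h⟩ := hC.exists_forall_le' (f := fun z => min (area z) (min (turn z) (1 - turn z)))
    (a := 0) (continuous_area.continuousOn.inf (ht.inf (continuousOn_const.sub ht)))
    fun z hz => lt_min (area_pos_of_mem (hs hz))
      (lt_min (turn_mem (hs hz)).1 (sub_pos.2 (turn_mem (hs hz)).2))
  refine ⟨min δ (1 / 4), lt_min hδ (by norm_num), min_le_right _ _, fun z hz => ?_⟩
  have h1 := (min_le_left δ (1 / 4)).trans (h z hz)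
  rw [le_min_iff, le_min_iff] at h1
  exact ⟨⟨h1.1, hM z hz⟩, h1.2.1, by linarith [h1.2.2]⟩

theorem area_planeFlow_radial {κ : ℝ → ℝ} (hκ : Differentiable ℝ κ)
    (ht : IsTestFun fun w => κ (area w)) (s : ℝ) {z : ℂ} (hz : 0 < area z) :
    area (planeFlow (fun w => κ (area w)) s z) = area z := by
  have h := ht.eq_planeFlow_of_Icc
    (γ := fun t => pol (area z) (turn z + t * (s * deriv κ (area z)))) s
    (fun t _ => hasDerivWithinAt_rotation hz (hκ _).hasDerivAt fun w => rfl)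
    (t := 1) ⟨zero_le_one, le_rfl⟩
  simp only [one_mul, zero_mul, add_zero, pol_area_turn] at h
  rw [← h, area_pol hz.le]

/-! ### Points of the quadrilateral domains -/

theorem mem_quadDomain_of_stair {A B : ℝ} (hA : 0 < A) (hAB : A ≤ B) {p : ℂ × ℂ}
    (h1 : area p.1 ≤ 2 * A - area p.2 / 2) (h2 : area p.2 ≤ A + B) : p ∈ quadDomain A B := by
  refine ⟨area_nonneg p.1, h1.trans ?_, area_nonneg p.2, h2⟩
  change _ ≤ 2 * A - A * area p.2 / (A + B)
  have : A * area p.2 / (A + B) ≤ area p.2 / 2 := by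
    rw [div_le_div_iff₀ (by linarith) (by norm_num)]
    nlinarith [area_nonneg p.2]
  linarith

theorem mem_quadDomain_of_le {A B : ℝ} (hA : 0 < A) (hAB : A ≤ B) {p : ℂ × ℂ}
    (h1 : area p.1 ≤ A) (h2 : area p.2 ≤ A + B) : p ∈ quadDomain A B := by
  refine ⟨area_nonneg p.1, h1.trans ?_, area_nonneg p.2, h2⟩
  change _ ≤ 2 * A - A * area p.2 / (A + B)
  have : A * area p.2 / (A + B) ≤ A := by
    rw [div_le_iff₀ (by linarith)]
    nlinarith
  linarith

/-! ### Opening both factors of the torus -/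

/-- The curve of `exists_keyhole` lies in a sector. -/
theorem exists_keyhole_sector {c α η uc τ : ℝ} (hτ : 0 < τ) (hτ' : τ ≤ 1 / 20) (hη : 0 < η)
    (hα : 0 ≤ α) (huc : 0 < uc) (hucα : uc ≤ c - α) (hs : 20 * τ * (c + α + η) ≤ η) :
    ∃ κ, 0 ≤ κ ∧ κ ≤ α + η ∧ ∃ δ, 0 < δ ∧ δ ≤ 1 / 4 ∧ ∃ h₁ h₂, IsTestFun h₁ ∧ IsTestFun h₂ ∧
      ∀ w, area w = c →
      (∀ t ∈ Icc (0 : ℝ) 1, area (planeFlow h₁ t w) ≤ c + κ) ∧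
      (∀ t ∈ Icc (0 : ℝ) 1, area (planeFlow h₂ t (planeFlow h₁ 1 w)) ≤ c + κ) ∧
      planeFlow h₂ 1 (planeFlow h₁ 1 w) ∈ {q | q ∈ sector δ (c + κ) δ (1 - δ) ∧
        (uc ≤ area q → area q = keyholeProfile c α κ (uc / 16) τ (turn q))} := by
  obtain ⟨κ, hκ0, hκ1, h₁, h₂, ht₁, ht₂, H⟩ := exists_keyhole hτ hτ' hη hα huc hucα hs
  have hC : IsCompact ((fun w => planeFlow h₂ 1 (planeFlow h₁ 1 w)) ''
      {w | c ≤ area w ∧ area w ≤ c}) :=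
    (isCompact_area c c).image ((ht₂.continuous_planeFlow zero_le_one).comp
      (ht₁.continuous_planeFlow zero_le_one))
  obtain ⟨δ, hδ, hδ', hsub⟩ := exists_subset_sector hC (M := c + κ)
    (by rintro _ ⟨w, hw, rfl⟩; exact (H w (le_antisymm hw.2 hw.1)).2.2.1)
    (by rintro _ ⟨w, hw, rfl⟩; exact (H w (le_antisymm hw.2 hw.1)).2.1 1 ⟨zero_le_one, le_rfl⟩)
  refine ⟨κ, hκ0, hκ1, δ, hδ, hδ', h₁, h₂, ht₁, ht₂, fun w hw => ?_⟩
  obtain ⟨e1, e2, -, e4⟩ := H w hw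
  exact ⟨e1, e2, hsub ⟨w, ⟨hw.ge, hw.le⟩, rfl⟩, e4⟩

theorem exists_small_pos {x y z : ℝ} (hx : 0 < x) (hy : 0 < y) (hz : 0 < z) :
    ∃ τ, 0 < τ ∧ τ ≤ x ∧ 20 * τ * y ≤ z := by
  refine ⟨min x (z / (20 * y)), lt_min hx (by positivity), min_le_left _ _, ?_⟩
  have : min x (z / (20 * y)) * (20 * y) ≤ z :=
    (le_div_iff₀ (by positivity)).1 (min_le_right _ _)
  linarith

/-- Opening both circles. The parameter `τ` of the second curve is chosen after the sector
`δ ≤ y ≤ 1 - δ` of the first curve, because the fold rotates by up to `(1 - δ) / 2`. -/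
theorem movable_to_sectors {a b ε η : ℝ} (ha : 0 < a) (hη : 0 < η) (hηε : 20 * η ≤ ε)
    (hηa : η ≤ a) (hb : 2 * a + 2 * ε < b) :
    ∃ δ τ κ r, 0 < δ ∧ δ ≤ 1 / 4 ∧ 0 < τ ∧ 16 * τ ≤ δ ∧ 0 ≤ κ ∧ κ ≤ a + η ∧ 0 < r ∧
      r ≤ δ / 4 ∧ r ≤ η ∧
      Movable (quadDomain (a + ε) (b + ε)) (productTorus a b)
        {p | p.1 ∈ sector r (a + η) δ (1 - δ) ∧ p.2 ∈ sector r (b + κ) r (1 - r) ∧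
          (η ≤ area p.2 → area p.2 = keyholeProfile b a κ (η / 16) τ (turn p.2))} := by
  obtain ⟨τ₁, hτ₁, hτ₁', hs₁⟩ := exists_small_pos (x := 1 / 20) (y := a + 0 + η) (z := η)
    (by norm_num) (by linarith) hη
  obtain ⟨κ₁, hκ₁, hκ₁', δ, hδ, hδ', f₁, f₂, hf₁, hf₂, Hf⟩ := exists_keyhole_sector hτ₁ hτ₁' hη
    le_rfl hη (by linarith) hs₁
  obtain ⟨τ, hτ, hτ', hs⟩ := exists_small_pos (x := δ / 16) (y := b + a + η) (z := η)
    (by positivity) (by linarith) hη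
  obtain ⟨κ, hκ, hκ', δ₂, hδ₂, hδ₂', g₁, g₂, hg₁, hg₂, Hg⟩ := exists_keyhole_sector hτ
    (by linarith) hη ha.le hη (by linarith) hs
  obtain ⟨r, hr, r1, r2, r3⟩ : ∃ r, 0 < r ∧ r ≤ δ / 4 ∧ r ≤ δ₂ ∧ r ≤ η :=
    ⟨min (δ / 4) (min δ₂ η), by positivity, min_le_left _ _,
      (min_le_right _ _).trans (min_le_left _ _), (min_le_right _ _).trans (min_le_right _ _)⟩
  refine ⟨δ, τ, κ, r, hδ, hδ', hτ, by linarith, hκ, hκ', hr, r1, r3, ?_⟩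
  have hV : ∀ p : ℂ × ℂ, area p.1 ≤ a + κ₁ → area p.2 ≤ b + κ →
      p ∈ quadDomain (a + ε) (b + ε) := fun p h1 h2 =>
    mem_quadDomain_of_le (by linarith) (by linarith) (by linarith) (by linarith)
  set C₁ : Set ℂ := planeFlow f₁ 1 '' {z | area z = a} with hC₁
  set C₂ : Set ℂ := sector δ (a + κ₁) δ (1 - δ) with hC₂
  have m1 : Movable (quadDomain (a + ε) (b + ε)) (productTorus a b)
      {p | p.1 ∈ C₁ ∧ area p.2 = b} :=
    movable_fst hf₁ (r := Real.sqrt (b / Real.pi))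
      (fun p hp => norm_le_of_area_le (le_of_eq hp.2))
      (fun t ht p hp => hV _ ((Hf p.1 hp.1).1 t ht) (by
        have : area p.2 = b := hp.2
        change area p.2 ≤ _; linarith))
      (fun p hp => ⟨mem_image_of_mem _ hp.1, hp.2⟩)
  have m2 : Movable (quadDomain (a + ε) (b + ε)) {p | p.1 ∈ C₁ ∧ area p.2 = b}
      {p | p.1 ∈ C₂ ∧ area p.2 = b} := by
    refine movable_fst hf₂ (r := Real.sqrt (b / Real.pi))
      (fun p hp => norm_le_of_area_le (le_of_eq hp.2)) (fun t ht p hp => ?_) (fun p hp => ?_)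
    · obtain ⟨⟨z, hz, e⟩, hw⟩ := hp
      refine hV _ ?_ ?_
      · change area (planeFlow f₂ t p.1) ≤ _
        rw [← e]
        exact (Hf z hz).2.1 t ht
      · change area p.2 ≤ _; linarith
    · obtain ⟨⟨z, hz, e⟩, hw⟩ := hp
      refine ⟨?_, hw⟩
      change planeFlow f₂ 1 p.1 ∈ _
      rw [← e]
      exact (Hf z hz).2.2.1
  have m3 : Movable (quadDomain (a + ε) (b + ε)) {p | p.1 ∈ C₂ ∧ area p.2 = b}
      {p | p.1 ∈ C₂ ∧ p.2 ∈ planeFlow g₁ 1 '' {w | area w = b}} :=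
    movable_snd hg₁ (r := Real.sqrt ((a + κ₁) / Real.pi))
      (fun p hp => norm_le_of_area_le hp.1.1.2)
      (fun t ht p hp => hV _ hp.1.1.2 ((Hg p.2 hp.2).1 t ht))
      (fun p hp => ⟨hp.1, mem_image_of_mem _ hp.2⟩)
  refine m1.trans (m2.trans (m3.trans ?_))
  refine movable_snd hg₂ (r := Real.sqrt ((a + κ₁) / Real.pi))
    (fun p hp => norm_le_of_area_le hp.1.1.2) (fun t ht p hp => ?_) (fun p hp => ?_)
  · obtain ⟨hz, w, hw, e⟩ := hp
    refine hV _ hz.1.2 ?_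
    change area (planeFlow g₂ t p.2) ≤ _
    rw [← e]
    exact (Hg w hw).2.1 t ht
  · obtain ⟨hz, w, hw, e⟩ := hp
    have hq := (Hg w hw).2.2
    rw [e] at hq
    exact ⟨⟨⟨by linarith [hz.1.1], by linarith [hz.1.2]⟩, hz.2⟩,
      ⟨⟨r2.trans hq.1.1.1, hq.1.1.2⟩, r2.trans hq.1.2.1, hq.1.2.2.trans (by linarith)⟩, hq.2⟩

/-! ### Lifting half of the second curve -/

/-- The profile of the second curve after the half turn `v > 1/2` has been moved outwards by the
area `U`. -/
noncomputable def liftedProfile (a b κ m τ U v : ℝ) : ℝ :=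
  keyholeProfile b a κ m τ v + U * smoothStep (1 / 2 + τ) (1 / 2 + 2 * τ) v

section

variable {a b κ m τ U v : ℝ}

theorem contDiff_liftedProfile : ContDiff ℝ ∞ (liftedProfile a b κ m τ U) :=
  contDiff_keyholeProfile.add (contDiff_const.mul contDiff_smoothStep)

theorem liftedProfile_left (hτ : 0 < τ) (hτ' : τ ≤ 1 / 20) (hv : v ≤ 2 * τ) :
    liftedProfile a b κ m τ U v = b - dip τ v * (b - m) := by
  rw [liftedProfile, keyholeProfile_left hτ hτ' hv, smoothStep_of_le (by linarith) (by linarith)]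
  ring

theorem liftedProfile_right (hτ : 0 < τ) (hτ' : τ ≤ 1 / 20) (hv : 1 - 2 * τ ≤ v) :
    liftedProfile a b κ m τ U v = U + (b - a) - dip τ (v - 1) * (b - a - m) := by
  rw [liftedProfile, keyholeProfile_right hτ hτ' hv, smoothStep_of_ge (by linarith) (by linarith)]
  ring

theorem le_liftedProfile (hτ : 0 < τ) (hκ : 0 ≤ κ) (haU : a ≤ U) (hv : 2 * τ ≤ v)
    (hv' : v ≤ 1 - 2 * τ) : b ≤ liftedProfile a b κ m τ U v := by
  rw [liftedProfile, keyholeProfile_middle hτ hv hv']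
  have h1 := mul_nonneg hκ (hump_nonneg (τ := τ) (v := v))
  have h2 := mul_nonneg (sub_nonneg.2 haU)
    (smoothStep_nonneg (lo := 1 / 2 + τ) (hi := 1 / 2 + 2 * τ) (x := v))
  linarith

theorem keyholeProfile_add_le {M t : ℝ} (hτ : 0 < τ) (hτ' : τ ≤ 1 / 20) (ha : 0 ≤ a)
    (hma : m ≤ b - a) (hκ : 0 ≤ κ) (hκM : b + κ ≤ M) (hUM : b - a + U ≤ M) (hU : 0 ≤ U)
    (ht : t ∈ Icc (0 : ℝ) 1) :
    keyholeProfile b a κ m τ v + t * (U * smoothStep (1 / 2 + τ) (1 / 2 + 2 * τ) v) ≤ M := by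
  have hd := dip_nonneg (τ := τ) (v := v)
  have hd' := dip_nonneg (τ := τ) (v := v - 1)
  have htU : t * U ≤ U := mul_le_of_le_one_left hU ht.2
  rcases le_total v (2 * τ) with h1 | h1
  · rw [keyholeProfile_left hτ hτ' h1, smoothStep_of_le (by linarith) (by linarith)]
    nlinarith [mul_nonneg hd (show 0 ≤ b - m by linarith)]
  rcases le_total v (1 - 2 * τ) with h2 | h2
  · rw [keyholeProfile_middle hτ h1 h2]
    rcases le_total v (1 / 2 + τ) with h3 | h3
    · rw [smoothStep_of_le (by linarith) h3]
      nlinarith [mul_le_mul_of_nonneg_left (hump_le_one (τ := τ) (v := v)) hκ]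
    · rw [hump_of_ge hτ (by linarith)]
      have s0 := smoothStep_nonneg (lo := 1 / 2 + τ) (hi := 1 / 2 + 2 * τ) (x := v)
      have s1 := smoothStep_le_one (lo := 1 / 2 + τ) (hi := 1 / 2 + 2 * τ) (x := v)
      set s := smoothStep (1 / 2 + τ) (1 / 2 + 2 * τ) v
      nlinarith [mul_le_mul_of_nonneg_right htU s0]
  · rw [keyholeProfile_right hτ hτ' h2, smoothStep_of_ge (by linarith) (by linarith)]
    nlinarith [mul_nonneg hd' (show 0 ≤ b - a - m by linarith)]

end

/-- A Hamiltonian depending on the angle alone moves the half turn `v > 1/2` of the second curve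
outwards by the area `U`, with a shear along rays in between. -/
theorem movable_lift {V : Set (ℂ × ℂ)} {a b κ τ r m U M η δ x₁ : ℝ} (hr : 0 < r)
    (hτ : 0 < τ) (hτ' : τ ≤ 1 / 20) (ha : 0 ≤ a) (hma : m ≤ b - a) (hκ : 0 ≤ κ)
    (hκM : b + κ ≤ M) (hUM : b - a + U ≤ M) (hηM : η + U ≤ M) (hU : 0 ≤ U)
    (hV : ∀ p : ℂ × ℂ, area p.1 ≤ x₁ → area p.2 ≤ M → p ∈ V) :
    Movable V {p | p.1 ∈ sector r x₁ δ (1 - δ) ∧ p.2 ∈ sector r (b + κ) r (1 - r) ∧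
          (η ≤ area p.2 → area p.2 = keyholeProfile b a κ m τ (turn p.2))}
      {p | p.1 ∈ sector r x₁ δ (1 - δ) ∧ p.2 ∈ sector r M r (1 - r) ∧
          (area p.2 = liftedProfile a b κ m τ U (turn p.2) ∨
            (area p.2 < η + U * smoothStep (1 / 2 + τ) (1 / 2 + 2 * τ) (turn p.2) ∧
            U * smoothStep (1 / 2 + τ) (1 / 2 + 2 * τ) (turn p.2) ≤ area p.2))} := by
  set S : ℝ → ℝ := smoothStep (1 / 2 + τ) (1 / 2 + 2 * τ) with hS
  have hSs : ContDiff ℝ ∞ S := contDiff_smoothStep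
  set k : ℝ → ℝ := fun v => -∫ s in (0 : ℝ)..v, U * S s with hk
  have dk : ∀ v, HasDerivAt k (-(U * S v)) v := fun v =>
    ((continuous_const.mul hSs.continuous).integral_hasStrictDerivAt 0 v).hasDerivAt.neg
  have sk : ContDiff ℝ ∞ k := by
    refine contDiff_infty_iff_deriv.2 ⟨fun v => (dk v).differentiableAt, ?_⟩
    rw [show deriv k = fun v => -(U * S v) from funext fun v => (dk v).deriv]
    exact (contDiff_const.mul hSs).neg
  obtain ⟨h, hh, hn⟩ := exists_isTestFun_eq_near (K := sector r M r (1 - r))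
    (sk.comp_contDiffOn contDiffOn_turn)
    (isCompact_sector hr hr (by linarith)) Complex.isOpen_slitPlane
    (sector_subset_slitPlane hr (by linarith))
  have key : ∀ w ∈ sector r (b + κ) r (1 - r),
      (η ≤ area w → area w = keyholeProfile b a κ m τ (turn w)) → ∀ t ∈ Icc (0 : ℝ) 1,
      (r ≤ area w + t * (U * S (turn w)) ∧ area w + t * (U * S (turn w)) ≤ M) ∧
      planeFlow h t w = pol (area w + t * (U * S (turn w))) (turn w) := by
    intro w hw hwk
    have hS0 : 0 ≤ S (turn w) := smoothStep_nonneg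
    have hS1 : S (turn w) ≤ 1 := smoothStep_le_one
    have hb : ∀ t ∈ Icc (0 : ℝ) 1,
        r ≤ area w + t * (U * S (turn w)) ∧ area w + t * (U * S (turn w)) ≤ M := by
      intro t ht
      have h0 : 0 ≤ t * (U * S (turn w)) := mul_nonneg ht.1 (mul_nonneg hU hS0)
      refine ⟨by linarith [hw.1.1], ?_⟩
      rcases le_or_gt η (area w) with hη' | hη'
      · rw [hwk hη']
        exact keyholeProfile_add_le hτ hτ' ha hma hκ hκM hUM hU ht
      · have h1 : t * (U * S (turn w)) ≤ U * S (turn w) :=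
          mul_le_of_le_one_left (mul_nonneg hU hS0) ht.2
        have h2 : U * S (turn w) ≤ U := mul_le_of_le_one_right hU hS1
        linarith
    intro t ht
    refine ⟨hb t ht, ?_⟩
    have e := hh.eq_planeFlow_of_Icc (γ := fun t => pol (area w - t * (1 * (-(U * S (turn w)))))
      (turn w)) 1 (fun t ht => ?_) ht
    · simp only [zero_mul, sub_zero, pol_area_turn, mul_one, one_mul] at e
      rw [← e]
      congr 1; ring
    · have e' : area w - t * (1 * (-(U * S (turn w)))) = area w + t * (U * S (turn w)) := by ring
      have hpos : 0 < area w - t * (1 * (-(U * S (turn w)))) := by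
        rw [e']; exact hr.trans_le (hb t ht).1
      refine hasDerivWithinAt_ray hpos (turn_pos w) (by linarith [hw.2.2]) (dk _) (hn _ ?_)
      exact pol_mem_sector hr hr (by linarith) (e' ▸ (hb t ht).1) (e' ▸ (hb t ht).2) hw.2.1 hw.2.2
  refine movable_snd hh (r := Real.sqrt (x₁ / Real.pi))
    (fun p hp => norm_le_of_area_le hp.1.1.2) (fun t ht p hp => ?_) (fun p hp => ?_)
  · obtain ⟨hz, hw, hwk⟩ := hp
    obtain ⟨hb, e⟩ := key p.2 hw hwk t ht
    refine hV _ hz.1.2 ?_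
    change area (planeFlow h t p.2) ≤ _
    rw [e, area_pol (by linarith)]
    exact hb.2
  · obtain ⟨hz, hw, hwk⟩ := hp
    obtain ⟨hb, e⟩ := key p.2 hw hwk 1 ⟨zero_le_one, le_rfl⟩
    rw [one_mul] at hb e
    refine ⟨hz, ?_⟩
    change planeFlow h 1 p.2 ∈ _ ∧ (area (planeFlow h 1 p.2) = liftedProfile a b κ m τ U
      (turn (planeFlow h 1 p.2)) ∨ (area (planeFlow h 1 p.2) < η + U * S (turn (planeFlow h 1 p.2))
      ∧ U * S (turn (planeFlow h 1 p.2)) ≤ area (planeFlow h 1 p.2)))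
    have hpos : 0 < area p.2 + U * S (turn p.2) := hr.trans_le hb.1
    rw [e, area_pol hpos.le, turn_pol hpos (turn_pos _) (by linarith [hw.2.2])]
    refine ⟨pol_mem_sector hr hr (by linarith) hb.1 hb.2 hw.2.1 hw.2.2, ?_⟩
    rcases le_or_gt η (area p.2) with hη' | hη'
    · left; rw [hwk hη', liftedProfile]
    · right
      exact ⟨by linarith, by linarith [area_nonneg p.2]⟩

/-! ### Folding -/

/-- The primitive of half a step function from `1` (below `u₁`) to `0` (above `u₂`) which vanishes
above `u₂`. -/
noncomputable def foldProfile (u₁ u₂ u : ℝ) : ℝ :=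
  -∫ s in u₂..u, (1 - smoothStep u₁ u₂ s) / 2

section

variable {u₁ u₂ u : ℝ}

theorem hasDerivAt_foldProfile :
    HasDerivAt (foldProfile u₁ u₂) (-((1 - smoothStep u₁ u₂ u) / 2)) u :=
  (((continuous_const.sub contDiff_smoothStep.continuous).div_const
    2).integral_hasStrictDerivAt u₂ u).hasDerivAt.neg

theorem contDiff_foldProfile : ContDiff ℝ ∞ (foldProfile u₁ u₂) := by
  refine contDiff_infty_iff_deriv.2 ⟨fun v => hasDerivAt_foldProfile.differentiableAt, ?_⟩
  rw [show deriv (foldProfile u₁ u₂) = fun u => -((1 - smoothStep u₁ u₂ u) / 2) from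
    funext fun v => hasDerivAt_foldProfile.deriv]
  exact ((contDiff_const.sub contDiff_smoothStep).div_const 2).neg

theorem foldProfile_of_ge (h : u₁ < u₂) (hu : u₂ ≤ u) : foldProfile u₁ u₂ u = 0 := by
  rw [foldProfile, neg_eq_zero]
  refine intervalIntegral.integral_zero_ae (Filter.Eventually.of_forall fun s hs => ?_)
  rw [smoothStep_of_ge h ((le_min le_rfl hu).trans hs.1.le)]; norm_num

theorem continuous_half_step : Continuous fun s => (1 - smoothStep u₁ u₂ s) / 2 :=
  (continuous_const.sub contDiff_smoothStep.continuous).div_const 2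

theorem foldProfile_le (hu : u ≤ u₂) : foldProfile u₁ u₂ u ≤ (u₂ - u) / 2 := by
  rw [foldProfile, ← intervalIntegral.integral_symm]
  have := integral_le_const_mul (continuous_half_step (u₁ := u₁) (u₂ := u₂)) (C := 1 / 2) hu
    fun t _ => by linarith [smoothStep_nonneg (lo := u₁) (hi := u₂) (x := t)]
  linarith

theorem foldProfile_nonneg (h : u₁ < u₂) : 0 ≤ foldProfile u₁ u₂ u := by
  rcases le_total u u₂ with hu | hu
  · rw [foldProfile, ← intervalIntegral.integral_symm]
    have := const_mul_le_integral (continuous_half_step (u₁ := u₁) (u₂ := u₂)) (C := 0) hu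
      fun t _ => by linarith [smoothStep_le_one (lo := u₁) (hi := u₂) (x := t)]
    linarith
  · rw [foldProfile_of_ge h hu]

theorem le_foldProfile (h : u₁ < u₂) (hu : u ≤ u₁) : (u₁ - u) / 2 ≤ foldProfile u₁ u₂ u := by
  have i : ∀ x y, IntervalIntegrable (fun s => (1 - smoothStep u₁ u₂ s) / 2)
      MeasureTheory.volume x y := fun x y => continuous_half_step.intervalIntegrable x y
  rw [foldProfile, ← intervalIntegral.integral_symm,
    ← intervalIntegral.integral_add_adjacent_intervals (i u u₁) (i u₁ u₂)]
  have h1 := const_mul_le_integral (continuous_half_step (u₁ := u₁) (u₂ := u₂)) (C := 1 / 2) hu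
    fun t ht => by rw [smoothStep_of_le h ht.2]; norm_num
  have h2 := const_mul_le_integral (continuous_half_step (u₁ := u₁) (u₂ := u₂)) (C := 0) h.le
    fun t _ => by linarith [smoothStep_le_one (lo := u₁) (hi := u₂) (x := t)]
  linarith

end

/-- The fold, generated by `-y σ(u)`, where `y` is the angle of the first coordinate, `u` the
area of the second one, and `σ` the function `foldProfile`. It increases the area of the first
coordinate by `σ(u)` and rotates the second one by `y / 2` where `u` is small. This separates the
two rays of the lifted curve from each other and the center of the curve from both. -/
theorem movable_fold {a b ε η κ τ r m δ M : ℝ} (ha : 0 < a) (hη : 0 < η) (hηε : 20 * η ≤ ε)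
    (hb : 2 * a + 2 * ε < b) (hr : 0 < r) (hrδ : r ≤ δ / 4) (hδ : δ ≤ 1 / 4) (hτ : 0 < τ)
    (hτδ : 16 * τ ≤ δ) (hκ : 0 ≤ κ) (hm0 : 0 < m) (hm : m ≤ b - a) (hM : M ≤ a + b + 10 * η) :
    Movable (quadDomain (a + ε) (b + ε))
      {p | p.1 ∈ sector r (a + η) δ (1 - δ) ∧ p.2 ∈ sector r M r (1 - r) ∧
          (area p.2 = liftedProfile a b κ m τ (2 * a + 10 * η) (turn p.2) ∨
            (area p.2 < η +
              (2 * a + 10 * η) * smoothStep (1 / 2 + τ) (1 / 2 + 2 * τ) (turn p.2) ∧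
            (2 * a + 10 * η) * smoothStep (1 / 2 + τ) (1 / 2 + 2 * τ) (turn p.2) ≤ area p.2))}
      {p | 0 < area p.1 ∧ p.2 ∈ sector r M r (1 - r) ∧
        ((area p.1 + area p.2 / 2 ≤ 2 * a + 20 * η ∧ area p.2 < 2 * a + 12 * η ∧
          (a + 2 * η ≤ area p.1 ∨ turn p.2 < 1 / 2 - δ / 8 ∨ 1 / 2 < turn p.2)) ∨
        (area p.1 ≤ a + η ∧
          area p.2 = liftedProfile a b κ m τ (2 * a + 10 * η) (turn p.2)))} := by
  have hu : 2 * a + 8 * η < 2 * a + 10 * η := by linarith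
  set σ := foldProfile (2 * a + 8 * η) (2 * a + 10 * η) with hσ
  set S := smoothStep (2 * a + 8 * η) (2 * a + 10 * η) with hS
  have hg : IsTestFun fun w => σ (area w) := by
    refine ⟨contDiff_foldProfile.comp contDiff_area, ?_⟩
    refine HasCompactSupport.intro (isCompact_area 0 (2 * a + 10 * η)) fun w hw => ?_
    refine foldProfile_of_ge hu (le_of_not_ge fun h => hw ⟨area_nonneg w, h⟩)
  have hX : 0 < 2 * a + 7 * η := by linarith
  obtain ⟨f, hf, hn⟩ := exists_isTestFun_eq_near
    (K := sector r (2 * a + 7 * η) δ (1 - δ)) contDiffOn_turn.neg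
    (isCompact_sector hr (by linarith) (by linarith)) Complex.isOpen_slitPlane
    (sector_subset_slitPlane hr (by linarith))
  refine movable_of_trajectories hf hg fun p hp => ?_
  obtain ⟨hz, hw, hor⟩ := hp
  set x := area p.1 with hx
  set y := turn p.1 with hy
  set u := area p.2 with hu'
  set v := turn p.2 with hv
  obtain ⟨⟨hx0, hx1⟩, hy0, hy1⟩ := hz
  obtain ⟨⟨hu0, hu1⟩, hv0, hv1⟩ := hw
  have hupos : 0 < u := hr.trans_le hu0
  have hσ0 : 0 ≤ σ u := foldProfile_nonneg hu
  have hσ1 : u ≤ 2 * a + 10 * η → σ u ≤ (2 * a + 10 * η - u) / 2 := foldProfile_le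
  have hσ2 : 2 * a + 10 * η ≤ u → σ u = 0 := foldProfile_of_ge hu
  have hσ3 : u ≤ 2 * a + 8 * η → (2 * a + 8 * η - u) / 2 ≤ σ u := le_foldProfile hu
  have hfz : f p.1 = -y := by
    refine (hn p.1 ⟨⟨hx0, ?_⟩, hy0, hy1⟩).self_of_nhds
    rw [← hx]; linarith
  have hS0 : 0 ≤ S u := smoothStep_nonneg
  have hS1 : S u ≤ 1 := smoothStep_le_one
  have hS2 : 2 * a + 10 * η ≤ u → S u = 1 := smoothStep_of_ge hu
  have hXle : ∀ t ∈ Icc (0 : ℝ) 1, x - t * (σ u * (-1)) ≤ x + σ u ∧ x ≤ x - t * (σ u * (-1)) :=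
    fun t ht => ⟨by nlinarith [mul_le_of_le_one_left hσ0 ht.2], by nlinarith [mul_nonneg ht.1 hσ0]⟩
  have hXu : x + σ u ≤ 2 * a + 7 * η := by
    rcases le_total u (2 * a + 10 * η) with h | h
    · linarith [hσ1 h]
    · linarith [hσ2 h]
  refine ⟨fun t => pol (x - t * (σ u * (-1))) y,
    fun t => pol u (v + t * (f p.1 * (-((1 - S u) / 2)))), ?_, ?_, fun t ht => ⟨?_, ?_, ?_⟩, ?_⟩
  · simp only [zero_mul, sub_zero]; exact pol_area_turn _
  · simp only [zero_mul, add_zero]; exact pol_area_turn _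
  · have hXt := hXle t ht
    refine hasDerivWithinAt_ray (κ := fun y => -y) (by linarith) (by linarith) (by linarith)
      (hasDerivAt_id y).neg (hn _ ?_)
    exact pol_mem_sector hr (by linarith) (by linarith) (by linarith) (by linarith) hy0 hy1
  · exact hasDerivWithinAt_rotation hupos hasDerivAt_foldProfile fun w => rfl
  · have hXt := hXle t ht
    have e1 : area (pol (x - t * (σ u * (-1))) y) = x - t * (σ u * (-1)) :=
      area_pol (by linarith) _
    have e2 : area (pol u (v + t * (f p.1 * (-((1 - S u) / 2))))) = u := area_pol hupos.le _
    rcases le_total u (2 * a + 10 * η) with h | h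
    · refine mem_quadDomain_of_stair (by linarith) (by linarith) ?_ ?_
      · simp only [e1, e2]; linarith [hσ1 h]
      · simp only [e2]; linarith
    · refine mem_quadDomain_of_le (by linarith) (by linarith) ?_ ?_
      · simp only [e1]; linarith [hσ2 h]
      · simp only [e2]; linarith
  · obtain ⟨v', hv'⟩ : ∃ v', v' = v + y * ((1 - S u) / 2) := ⟨_, rfl⟩
    have e1 : pol (x - 1 * (σ u * (-1))) y = pol (x + σ u) y := by congr 1; ring
    have e2 : pol u (v + 1 * (f p.1 * (-((1 - S u) / 2)))) = pol u v' := by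
      rw [hfz, hv']; congr 1; ring
    have a1 : area (pol (x + σ u) y) = x + σ u := area_pol (by linarith) _
    have a2 : area (pol u v') = u := area_pol hupos.le _
    have hvv' : v ≤ v' := by
      rw [hv']
      have : 0 ≤ y * ((1 - S u) / 2) := mul_nonneg (by linarith) (by linarith)
      linarith
    have hvv'' : v' ≤ v + (1 - δ) / 2 := by
      rw [hv']
      have : y * (1 - S u) ≤ y := mul_le_of_le_one_right (by linarith) (by linarith)
      linarith
    -- it remains to control the angle after the fold
    suffices H : v' ≤ 1 - r ∧ ((x + σ u + u / 2 ≤ 2 * a + 20 * η ∧ u < 2 * a + 12 * η ∧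
        (a + 2 * η ≤ x + σ u ∨ v' < 1 / 2 - δ / 8 ∨ 1 / 2 < v')) ∨
        (x + σ u ≤ a + η ∧ u = liftedProfile a b κ m τ (2 * a + 10 * η) v')) by
      have a3 : turn (pol u v') = v' := turn_pol hupos (by linarith) (by linarith [H.1])
      simp only [e1, e2]
      change 0 < area (pol (x + σ u) y) ∧ _ ∧ ((area (pol (x + σ u) y) + area (pol u v') / 2 ≤ _ ∧
        area (pol u v') < _ ∧ (_ ≤ area (pol (x + σ u) y) ∨ turn (pol u v') < _ ∨
          _ < turn (pol u v'))) ∨ (area (pol (x + σ u) y) ≤ _ ∧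
          area (pol u v') = liftedProfile a b κ m τ (2 * a + 10 * η) (turn (pol u v'))))
      rw [a1, a2, a3]
      exact ⟨by linarith, pol_mem_sector hr hr (by linarith) hu0 hu1 (by linarith) H.1, H.2⟩
    rcases le_or_gt (2 * a + 10 * η) u with h | h
    · have hvv : v' = v := by rw [hv', hS2 h]; ring
      rw [hvv, hσ2 h, add_zero]
      refine ⟨hv1, ?_⟩
      rcases hor with hA | ⟨hB, -⟩
      · exact Or.inr ⟨hx1, hA⟩
      · left
        have hs1 := smoothStep_le_one (lo := 1 / 2 + τ) (hi := 1 / 2 + 2 * τ) (x := v)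
        have hub : u < 2 * a + 11 * η := by
          have := mul_le_of_le_one_right (show 0 ≤ 2 * a + 10 * η by linarith) hs1
          linarith
        refine ⟨by linarith, by linarith, Or.inr (Or.inr ?_)⟩
        by_contra hcon
        rw [smoothStep_of_le (by linarith) (by linarith)] at hB
        linarith
    · have hst : x + σ u + u / 2 ≤ 2 * a + 20 * η := by linarith [hσ1 h.le]
      rcases hor with hA | ⟨hB, hB'⟩
      · rcases le_or_gt (2 * τ) v with h1 | h1
        · exfalso
          rcases le_or_gt v (1 - 2 * τ) with h2 | h2
          · have := le_liftedProfile (a := a) (b := b) (m := m) (U := 2 * a + 10 * η)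
              hτ hκ (by linarith) h1 h2
            linarith
          · rw [liftedProfile_right hτ (by linarith) h2.le] at hA
            have := dip_le_one (τ := τ) (v := v - 1)
            nlinarith [mul_le_mul_of_nonneg_right this (show 0 ≤ b - a - m by linarith)]
        · exact ⟨by linarith, Or.inl ⟨hst, by linarith, Or.inr (Or.inl (by linarith))⟩⟩
      · rcases le_or_gt v (1 / 2 + τ) with h1 | h1
        · rw [smoothStep_of_le (by linarith) h1] at hB
          have := hσ3 (by linarith)
          exact ⟨by linarith, Or.inl ⟨hst, by linarith, Or.inl (by linarith)⟩⟩
        · rcases le_or_gt (1 / 2 + 2 * τ) v with h2 | h2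
          · rw [smoothStep_of_ge (by linarith) h2] at hB'
            linarith
          · exact ⟨by linarith, Or.inl ⟨hst, by linarith, Or.inr (Or.inr (by linarith))⟩⟩

/-! ### Shrinking the outer arc -/

/-- A smooth function that vanishes below `x₀` and equals `x - x₀` above `x₁`. -/
noncomputable def excess (x₀ x₁ x : ℝ) : ℝ := (x - x₀) * smoothStep x₀ x₁ x

theorem contDiff_excess {x₀ x₁ : ℝ} : ContDiff ℝ ∞ (excess x₀ x₁) :=
  (contDiff_id.sub contDiff_const).mul contDiff_smoothStep

theorem excess_of_le {x₀ x₁ x : ℝ} (h : x₀ < x₁) (hx : x ≤ x₀) : excess x₀ x₁ x = 0 := by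
  rw [excess, smoothStep_of_le h hx, mul_zero]

theorem excess_mem {x₀ x₁ x : ℝ} (hx : x₀ ≤ x) : excess x₀ x₁ x ∈ Icc 0 (x - x₀) :=
  ⟨mul_nonneg (by linarith) smoothStep_nonneg,
    mul_le_of_le_one_right (by linarith) smoothStep_le_one⟩

theorem sub_excess_le {x₀ x₁ x : ℝ} (h : x₀ < x₁) (hx : x₀ ≤ x) : x - excess x₀ x₁ x ≤ x₁ := by
  rcases le_total x x₁ with h1 | h1
  · linarith [(excess_mem (x₁ := x₁) hx).1]
  · rw [excess, smoothStep_of_ge h h1]; linarith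

/-- A Hamiltonian of the plane that shrinks the part of the lifted curve at area at least `u₅`
to area at most `u₆`, and is locally constant near the rest of the curve, and near all points of
area less than `u₃` with angle less than `1/2 - δ/8` or greater than `1/2`. At large area it is a
function `F` of the angle, at small area a step function `E` of the angle which takes the values
that `F` has on the two ends of the curve. -/
theorem exists_shrinking {a b κ m τ U δ r M u₃ u₄ u₅ u₆ : ℝ} (hτ : 0 < τ) (hτδ : 16 * τ ≤ δ)
    (hδ : δ ≤ 1 / 4) (hκ : 0 ≤ κ) (haU : a ≤ U) (hm : m ≤ b - a) (ha : 0 ≤ a) (hr : 0 < r)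
    (hr' : r ≤ u₅) (h34 : u₃ < u₄) (h45 : u₄ < u₅) (h56 : u₅ < u₆) (h5b : u₅ < b) :
    ∃ G, IsTestFun G ∧ ∀ w ∈ sector r M r (1 - r),
      (area w < u₃ → (turn w < 1 / 2 - δ / 8 ∨ 1 / 2 < turn w) → planeHamVec G w = 0) ∧
      (area w = liftedProfile a b κ m τ U (turn w) →
        (area w < u₅ → planeHamVec G w = 0) ∧
        (u₅ ≤ area w → (∀ t ∈ Icc (0 : ℝ) 1, area (planeFlow G t w) ≤ area w) ∧
          area (planeFlow G 1 w) ≤ u₆)) := by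
  set f := liftedProfile a b κ m τ U with hf
  set l : ℝ → ℝ := fun v => excess u₅ u₆ (f v) with hl
  have sl : ContDiff ℝ ∞ l := contDiff_excess.comp contDiff_liftedProfile
  set F : ℝ → ℝ := fun v => ∫ s in (0 : ℝ)..v, l s with hF
  have dF : ∀ v, HasDerivAt F (l v) v := fun v =>
    (sl.continuous.integral_hasStrictDerivAt 0 v).hasDerivAt
  have sF : ContDiff ℝ ∞ F := by
    refine contDiff_infty_iff_deriv.2 ⟨fun v => (dF v).differentiableAt, ?_⟩
    rw [show deriv F = l from funext fun v => (dF v).deriv]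
    exact sl
  set E : ℝ → ℝ := fun v => F 1 * smoothStep (1 / 2 - δ / 8) (1 / 2) v with hE
  have hδ0 : 0 < δ := by linarith
  have E0 : ∀ v, v ≤ 1 / 2 - δ / 8 → E v = 0 := fun v hv => by
    simp only [hE]; rw [smoothStep_of_le (by linarith) hv, mul_zero]
  have E1 : ∀ v, 1 / 2 ≤ v → E v = F 1 := fun v hv => by
    simp only [hE]; rw [smoothStep_of_ge (by linarith) hv, mul_one]
  have sE : ContDiff ℝ ∞ E := contDiff_const.mul contDiff_smoothStep
  -- the profile is monotone near the two ends, so `F` is constant up to its level `u₅`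
  have F0 : ∀ v, 0 ≤ v → v ≤ 2 * τ → f v ≤ u₅ → F v = 0 := by
    intro v hv hv2 hfv
    refine intervalIntegral.integral_zero_ae (Filter.Eventually.of_forall fun s hs => ?_)
    rw [uIoc_of_le hv] at hs
    refine excess_of_le h56 (le_trans ?_ hfv)
    have hd := dip_antitoneOn (τ := τ) (show s ∈ Ici 0 from hs.1.le) (show v ∈ Ici 0 from hv) hs.2
    simp only [hf]
    rw [liftedProfile_left hτ (by linarith) (hs.2.trans hv2),
      liftedProfile_left hτ (by linarith) hv2]
    nlinarith
  have F1 : ∀ v, v ≤ 1 → 1 - 2 * τ ≤ v → f v ≤ u₅ → F v = F 1 := by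
    intro v hv hv2 hfv
    have h0 : ∫ s in v..1, l s = 0 := by
      refine intervalIntegral.integral_zero_ae (Filter.Eventually.of_forall fun s hs => ?_)
      rw [uIoc_of_le hv] at hs
      refine excess_of_le h56 (le_trans ?_ hfv)
      have hd := dip_antitoneOn (τ := τ) (show 1 - s ∈ Ici 0 from sub_nonneg.2 hs.2)
        (show 1 - v ∈ Ici 0 from sub_nonneg.2 hv) (by linarith [hs.1])
      rw [← dip_neg, neg_sub, ← dip_neg (v := 1 - s), neg_sub] at hd
      simp only [hf]
      rw [liftedProfile_right hτ (by linarith) (hv2.trans hs.1.le),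
        liftedProfile_right hτ (by linarith) hv2]
      nlinarith
    have := intervalIntegral.integral_add_adjacent_intervals
      (sl.continuous.intervalIntegrable (μ := MeasureTheory.volume) 0 v)
      (sl.continuous.intervalIntegrable v 1)
    rw [h0, add_zero] at this
    exact this
  set G₀ : ℂ → ℝ := fun w => E (turn w) + (F (turn w) - E (turn w)) * smoothStep u₃ u₄ (area w)
    with hG₀
  have sG₀ : ContDiffOn ℝ ∞ G₀ Complex.slitPlane :=
    (sE.comp_contDiffOn contDiffOn_turn).add (((sF.comp_contDiffOn contDiffOn_turn).sub
      (sE.comp_contDiffOn contDiffOn_turn)).mul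
      (contDiff_smoothStep.comp contDiff_area).contDiffOn)
  obtain ⟨G, hG, hn⟩ := exists_isTestFun_eq_near (K := sector r M r (1 - r)) sG₀
    (isCompact_sector hr hr (by linarith)) Complex.isOpen_slitPlane
    (sector_subset_slitPlane hr (by linarith))
  refine ⟨G, hG, fun w hw => ?_⟩
  have hws := sector_subset_slitPlane hr (show 1 - r < 1 by linarith) hw
  have ct : ContinuousAt turn w := (hasFDerivAt_turn hws).continuousAt
  have hstat : ∀ c : ℝ, G₀ =ᶠ[nhds w] (fun _ => c) → planeHamVec G w = 0 := fun c hc => by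
    rw [planeHamVec_congr ((hn w hw).trans hc), planeHamVec_const]
  have hv := turn_mem hws
  refine ⟨fun hu hor => ?_, fun hwf => ⟨fun hu => ?_, fun hu => ?_⟩⟩
  · have ha : ∀ᶠ x in nhds w, area x < u₃ :=
      continuous_area.continuousAt.eventually_lt continuousAt_const hu
    rcases hor with h | h
    · refine hstat 0 ?_
      filter_upwards [ha, ct.eventually_lt continuousAt_const h] with x hx hx'
      simp only [hG₀]
      rw [smoothStep_of_le h34 hx.le, E0 _ hx'.le, mul_zero, add_zero]
    · refine hstat (F 1) ?_
      filter_upwards [ha, continuousAt_const.eventually_lt ct h] with x hx hx'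
      simp only [hG₀]
      rw [smoothStep_of_le h34 hx.le, E1 _ hx'.le, mul_zero, add_zero]
  · rw [hwf] at hu
    have cf : ContinuousAt (fun x => f (turn x)) w :=
      ContinuousAt.comp (g := f) contDiff_liftedProfile.continuous.continuousAt ct
    have hfe := cf.eventually_lt continuousAt_const hu
    rcases lt_or_ge (turn w) (2 * τ) with h | h
    · refine hstat 0 ?_
      filter_upwards [hfe, ct.eventually_lt continuousAt_const h,
        continuousAt_const.eventually_lt ct hv.1] with x h1 h2 h3
      simp only [hG₀]
      rw [F0 _ h3.le h2.le h1.le, E0 _ (by linarith), sub_self, zero_mul, add_zero]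
    rcases le_or_gt (turn w) (1 - 2 * τ) with h' | h'
    · have := le_liftedProfile (a := a) (b := b) (m := m) (U := U) hτ hκ haU h h'
      linarith
    · refine hstat (F 1) ?_
      filter_upwards [hfe, ct.eventually_lt continuousAt_const hv.2,
        continuousAt_const.eventually_lt ct h'] with x h1 h2 h3
      simp only [hG₀]
      rw [F1 _ h2.le h3.le h1.le, E1 _ (by linarith), sub_self, zero_mul, add_zero]
  · have hex := excess_mem (x₁ := u₆) hu
    have hlw : l (turn w) = excess u₅ u₆ (area w) := by simp only [hl, ← hwf]
    have key : ∀ t ∈ Icc (0 : ℝ) 1,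
        planeFlow G t w = pol (area w - t * (1 * l (turn w))) (turn w) := by
      intro t ht
      have hb : ∀ t ∈ Icc (0 : ℝ) 1, u₅ ≤ area w - t * (1 * l (turn w)) ∧
          area w - t * (1 * l (turn w)) ≤ area w := fun t ht => by
        rw [one_mul, hlw]
        have h1 := mul_le_of_le_one_left hex.1 ht.2
        have h2 := mul_nonneg ht.1 hex.1
        exact ⟨by linarith [hex.2], by linarith⟩
      have e := hG.eq_planeFlow_of_Icc
        (γ := fun t => pol (area w - t * (1 * l (turn w))) (turn w)) 1 (fun t ht => ?_) ht
      · simp only [zero_mul, sub_zero, pol_area_turn, mul_one] at e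
        exact e.symm
      · have hpos : 0 < area w - t * (1 * l (turn w)) := by linarith [(hb t ht).1]
        refine hasDerivWithinAt_ray hpos hv.1 hv.2 (dF _) ((hn _ ?_).trans ?_)
        · exact pol_mem_sector hr hr (by linarith) (hr'.trans (hb t ht).1)
            ((hb t ht).2.trans hw.1.2) hw.2.1 hw.2.2
        · have hlt : u₄ < area (pol (area w - t * (1 * l (turn w))) (turn w)) := by
            rw [area_pol hpos.le]; linarith [(hb t ht).1]
          filter_upwards [continuousAt_const.eventually_lt continuous_area.continuousAt hlt]
            with x hx
          simp only [hG₀]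
          rw [smoothStep_of_ge h34 hx.le]; ring
    constructor
    · intro t ht
      rw [key t ht, hlw, area_pol]
      · nlinarith [mul_nonneg ht.1 hex.1]
      · nlinarith [mul_le_of_le_one_left hex.1 ht.2, hex.2]
    · rw [key 1 ⟨zero_le_one, le_rfl⟩, hlw, one_mul, one_mul, area_pol (by linarith [hex.2])]
      exact sub_excess_le h56 hu

/-- The outer arc is pulled in by the Hamiltonian of `exists_shrinking`, switched off at the center
of the curve by a cutoff in the area of the first coordinate. The first coordinate only rotates,
which does not matter because the domains are toric. -/
theorem movable_shrink {a b ε η κ τ r m δ M : ℝ} (ha : 0 < a) (hη : 0 < η) (hηε : 20 * η ≤ ε)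
    (hb : 2 * a + 2 * ε < b) (hr : 0 < r) (hrη : r ≤ η) (hδ : δ ≤ 1 / 4) (hτ : 0 < τ)
    (hτδ : 16 * τ ≤ δ) (hκ : 0 ≤ κ) (hm : m ≤ b - a) (hM : M ≤ a + b + 10 * η) :
    Movable (quadDomain (a + ε) (b + ε))
      {p | 0 < area p.1 ∧ p.2 ∈ sector r M r (1 - r) ∧
        ((area p.1 + area p.2 / 2 ≤ 2 * a + 20 * η ∧ area p.2 < 2 * a + 12 * η ∧
          (a + 2 * η ≤ area p.1 ∨ turn p.2 < 1 / 2 - δ / 8 ∨ 1 / 2 < turn p.2)) ∨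
        (area p.1 ≤ a + η ∧
          area p.2 = liftedProfile a b κ m τ (2 * a + 10 * η) (turn p.2)))}
      (quadDomain (a + ε) (a + ε)) := by
  obtain ⟨G, hG, H⟩ := exists_shrinking (a := a) (b := b) (κ := κ) (m := m) (r := r) (M := M)
    (U := 2 * a + 10 * η) (u₃ := 2 * a + 12 * η) (u₄ := 2 * a + 13 * η) (u₅ := 2 * a + 14 * η)
    (u₆ := 2 * a + 20 * η) hτ hτδ hδ hκ (by linarith) hm ha.le hr (by linarith) (by linarith)
    (by linarith) (by linarith) (by linarith)
  set χ : ℝ → ℝ := fun x => 1 - smoothStep (a + η) (a + 2 * η) x with hχ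
  have sχ : ContDiff ℝ ∞ χ := contDiff_const.sub contDiff_smoothStep
  have hf : IsTestFun fun z => χ (area z) := by
    refine ⟨sχ.comp contDiff_area, ?_⟩
    refine HasCompactSupport.intro (isCompact_area 0 (a + 2 * η)) fun z hz => ?_
    simp only [hχ]
    rw [smoothStep_of_ge (by linarith) (le_of_not_ge fun h => hz ⟨area_nonneg z, h⟩), sub_self]
  have key : ∀ p : ℂ × ℂ, 0 < area p.1 → ∀ t, area (productFlow (fun z => χ (area z)) G t p).1 =
      area p.1 := fun p hp t => area_planeFlow_radial (sχ.differentiable (by simp)) hf _ hp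
  have hQ : ∀ {B : ℝ}, a + ε ≤ B → ∀ q : ℂ × ℂ, area q.1 + area q.2 / 2 ≤ 2 * a + 20 * η →
      area q.2 ≤ 2 * a + 20 * η → q ∈ quadDomain (a + ε) B := fun hB q h1 h2 =>
    mem_quadDomain_of_stair (by linarith) hB (by linarith) (by linarith)
  -- a point where the second factor is stationary stays in the smaller quadrilateral
  have stat : ∀ p : ℂ × ℂ, 0 < area p.1 → area p.1 + area p.2 / 2 ≤ 2 * a + 20 * η →
      area p.2 ≤ 2 * a + 20 * η → (χ (area p.1) = 0 ∨ planeHamVec G p.2 = 0) → ∀ t,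
      productFlow (fun z => χ (area z)) G t p ∈ quadDomain (a + ε) (b + ε) ∧
      productFlow (fun z => χ (area z)) G t p ∈ quadDomain (a + ε) (a + ε) := by
    intro p hp h1 h2 hor t
    have e : (productFlow (fun z => χ (area z)) G t p).2 = p.2 := by
      change planeFlow G (t * χ (area p.1)) p.2 = p.2
      rcases hor with h | h
      · rw [h, mul_zero, hG.planeFlow_zero]
      · exact hG.planeFlow_eq_self h _
    constructor <;> refine hQ (by linarith) _ ?_ ?_ <;> rw [e] <;> try rw [key p hp t]
    all_goals assumption
  suffices hmain : ∀ p : ℂ × ℂ, 0 < area p.1 → p.2 ∈ sector r M r (1 - r) →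
      ((area p.1 + area p.2 / 2 ≤ 2 * a + 20 * η ∧ area p.2 < 2 * a + 12 * η ∧
          (a + 2 * η ≤ area p.1 ∨ turn p.2 < 1 / 2 - δ / 8 ∨ 1 / 2 < turn p.2)) ∨
        (area p.1 ≤ a + η ∧
          area p.2 = liftedProfile a b κ m τ (2 * a + 10 * η) (turn p.2))) →
      (∀ t ∈ Icc (0 : ℝ) 1,
        productFlow (fun z => χ (area z)) G t p ∈ quadDomain (a + ε) (b + ε)) ∧
      productFlow (fun z => χ (area z)) G 1 p ∈ quadDomain (a + ε) (a + ε) from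
    ⟨productFlow (fun z => χ (area z)) G, isHamiltonianFlow_productFlow hf hG,
      fun t ht p hp => (hmain p hp.1 hp.2.1 hp.2.2).1 t ht,
      fun p hp => (hmain p hp.1 hp.2.1 hp.2.2).2⟩
  intro p hp hw hor
  obtain ⟨H1, H2⟩ := H p.2 hw
  rcases hor with ⟨h1, h2, h3⟩ | ⟨h1, h2⟩
  · have h4 : χ (area p.1) = 0 ∨ planeHamVec G p.2 = 0 := by
      rcases h3 with h3 | h3
      · left
        simp only [hχ]
        rw [smoothStep_of_ge (by linarith) h3, sub_self]
      · exact Or.inr (H1 h2 h3)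
    have := stat p hp h1 (by linarith) h4
    exact ⟨fun t _ => (this t).1, (this 1).2⟩
  · obtain ⟨H3, H4⟩ := H2 h2
    rcases lt_or_ge (area p.2) (2 * a + 14 * η) with h | h
    · have := stat p hp (by linarith) (by linarith) (Or.inr (H3 h))
      exact ⟨fun t _ => (this t).1, (this 1).2⟩
    · obtain ⟨H5, H6⟩ := H4 h
      have e : ∀ t, (productFlow (fun z => χ (area z)) G t p).2 = planeFlow G t p.2 := fun t => by
        change planeFlow G (t * χ (area p.1)) p.2 = _
        simp only [hχ]
        rw [smoothStep_of_le (by linarith) h1, sub_zero, mul_one]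
      refine ⟨fun t ht => mem_quadDomain_of_le (by linarith) (by linarith) ?_ ?_,
        mem_quadDomain_of_le (by linarith) le_rfl ?_ ?_⟩
      · rw [key p hp t]; linarith
      · rw [e]; linarith [H5 t ht, hw.1.2]
      · rw [key p hp 1]; linarith
      · rw [e]; linarith

theorem theorem4p2 (a b ε : ℝ) (ha : 0 < a) (hab : a < b) (hε : 0 < ε) :
    ∃ L : ℝ → Set (ℂ × ℂ),
      IsHamiltonianIsotopy L ∧
      L 0 = productTorus a b ∧
      (∀ t ∈ Icc (0 : ℝ) 1, L t ⊆ quadDomain (a + ε) (b + ε)) ∧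
      L 1 ⊆ quadDomain (a + ε) (a + ε) := by
  refine Movable.exists_isHamiltonianIsotopy ?_
  rcases le_or_gt b (2 * a + 2 * ε) with hb | hb
  · refine Movable.of_subset (fun p hp => ?_) fun p hp => ?_
    all_goals
      have h1 : area p.1 = a := hp.1
      have h2 : area p.2 = b := hp.2
      exact mem_quadDomain_of_le (by linarith) (by linarith) (by linarith) (by linarith)
  · obtain ⟨η, hη, hηε, hηa⟩ : ∃ η, 0 < η ∧ 20 * η ≤ ε ∧ η ≤ a :=
      ⟨min (ε / 20) a, lt_min (by linarith) ha, by linarith [min_le_left (ε / 20) a],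
        min_le_right _ _⟩
    obtain ⟨δ, τ, κ, r, hδ, hδ', hτ, hτδ, hκ, hκ', hr, hrδ, hrη, hmov⟩ :=
      movable_to_sectors ha hη hηε hηa hb
    refine hmov.trans ((movable_lift (U := 2 * a + 10 * η) (M := a + b + 10 * η) hr hτ
      (by linarith) ha.le (by linarith) hκ (by linarith) (by linarith) (by linarith) (by linarith)
      fun p h1 h2 => mem_quadDomain_of_le (by linarith) (by linarith) (by linarith)
        (by linarith)).trans ((movable_fold ha hη hηε hb hr hrδ hδ' hτ hτδ hκ (by linarith)
      (by linarith) le_rfl).trans (movable_shrink ha hη hηε hb hr hrη hδ' hτ hτδ hκ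
      (by linarith) le_rfl)))
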